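/- **Theorem.** Let $(M,g)$ be a smooth ($C^\infty$) Riemannian manifold (without boundary) of dimension $n$, with Riemannian distance $d_M$. Then every connected, compact conic singular submanifold $W$ of $M$ is Lipschitz normally embedded: there is a constant $L>0$ such that $$d^W_{\mathrm{inn}}(x,x')\le L\, d_M(x,x')\qquad\text{for all } x,x'\in W,$$ where $d^W_{\mathrm{inn}}(x,x')\in[0,\infty]$ is the infimum of the $d_M$-lengths of the rectifiable paths lying in $W$ that join $x$ to $x'$. **Definitions.** Submanifolds are embedded, and their connected components may have different dimensions. The *spherical blow-up* of $\mathbb R^n$ at $a$ is the manifold with boundary $[\mathbb R^n,a]=[0,\infty)\times S^{n-1}$, with the map $\beta_a(r,u)=ru+a$ to $\mathbb R^n$. The *strict transform* $[S,a]$ of $S\subseteq\mathbb R^n$ is the closure of $\beta_a^{-1}(S\setminus\{a\})$ in $[\mathbb R^n,a]$. A subset $N$ of $[0,r)\times S^{n-1}$ is a *p-submanifold* if it is a smooth submanifold with boundary, its boundary is $\partial N=N\cap(\{0\}\times S^{n-1})$, and at each $x\in\partial N$ it is transverse to the boundary: $T_xN+T_x(\{0\}\times S^{n-1})=T_x([0,r)\times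 S^{n-1})$. A point $a$ is a *conic point* of $X\subseteq\mathbb R^n$ if $a\in X$, $X$ coincides with a closed set in a neighbourhood of $a$, and for some $r>0$ the set $[X\cap\{|x-a|<r\},a]\cap([0,r)\times S^{n-1})$ is a p-submanifold of $[0,r)\times S^{n-1}$. A subset $Z$ of $M$ is *conic at* $z\in Z$ if there is a smooth chart $\psi:U\to B^n$ of $M$ onto the open unit ball, with $\psi(z)=0$, such that $0$ is a conic point of $\psi(Z\cap U)$. A *singular point* of $Z\subseteq M$ is a point of $Z$ at which the germ of $Z$ is not that of a smooth submanifold (without boundary) of $M$. A subset $W$ of $M$ is a *conic singular submanifold* if it is closed in $M$, it is conic at each of its points, and the set of its singular points is finite (possibly empty). -/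

import Mathlib

open Set Topology Bundle
open scoped Manifold ContDiff ENNReal NNReal Bundle

noncomputable section

namespace ConicLNE

/-! ### Inner distance and Lipschitz normally embedded sets -/

/-- `γ`, restricted to `[0,1]`, is a continuous path lying in `S` and joining `x` to `y`. -/
def IsPathIn {M : Type*} [TopologicalSpace M] (S : Set M) (x y : M) (γ : ℝ → M) : Prop :=
  ContinuousOn γ (Icc 0 1) ∧ (∀ t ∈ Icc (0 : ℝ) 1, γ t ∈ S) ∧ γ 0 = x ∧ γ 1 = y

/-- The inner distance of `S`: the infimum of the lengths of the rectifiable paths lying in `S` that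
join `x` to `y` (it is `∞` if there is none). The length of a path is its total variation for the
distance of the ambient space; paths of infinite length do not affect the infimum. -/
def innerEDist {M : Type*} [PseudoEMetricSpace M] (S : Set M) (x y : M) : ℝ≥0∞ :=
  ⨅ (γ : ℝ → M) (_ : IsPathIn S x y γ), eVariationOn γ (Icc 0 1)

/-- `S` is Lipschitz normally embedded: its inner distance is at most a constant times its outer
distance, the restriction to `S` of the distance of the ambient space. -/
def IsLNE {M : Type*} [PseudoEMetricSpace M] (S : Set M) : Prop :=
  ∃ L : ℝ≥0, 0 < L ∧ ∀ x ∈ S, ∀ y ∈ S, innerEDist S x y ≤ L * edist x y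

/-! ### Embedded submanifolds, through local parametrizations -/

/-- `φ`, restricted to the open neighbourhood `V` of `0` in `ℝ^k`, is a smooth immersion and a
homeomorphism onto a (relatively) open neighbourhood of `p` in `N`, with `φ 0 = p`. -/
structure IsInteriorParam {F : Type*} [NormedAddCommGroup F] [NormedSpace ℝ F]
    (N : Set F) (p : F) {k : ℕ} (φ : EuclideanSpace ℝ (Fin k) → F)
    (V : Set (EuclideanSpace ℝ (Fin k))) : Prop where
  isOpen : IsOpen V
  zero_mem : 0 ∈ V
  map_zero : φ 0 = p
  smooth : ContDiffOn ℝ ∞ φ V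
  immersion : ∀ v ∈ V, Function.Injective (fderiv ℝ φ v)
  embedding : IsEmbedding (V.domRestrict φ)
  image : ∃ U : Set F, IsOpen U ∧ φ '' V = N ∩ U

/-- The germ of `N` at `p ∈ N` is that of a smooth submanifold (without boundary). The dimension `k`
of the submanifold may depend on the point. -/
def IsSmoothAt {F : Type*} [NormedAddCommGroup F] [NormedSpace ℝ F] (N : Set F) (p : F) : Prop :=
  ∃ (k : ℕ) (φ : EuclideanSpace ℝ (Fin k) → F) (V : Set (EuclideanSpace ℝ (Fin k))),
    IsInteriorParam N p φ V

/-- The half-space `[0,∞) × ℝ^k`. -/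
def halfSpace (k : ℕ) : Set (ℝ × EuclideanSpace ℝ (Fin k)) := {x | 0 ≤ x.1}

/-- `φ`, restricted to the relatively open neighbourhood `V ∩ halfSpace k` of `0` in the half-space,
is a smooth immersion and a homeomorphism onto a (relatively) open neighbourhood of `p` in `N`, with
`φ 0 = p`; so `p` is a boundary point of the manifold with boundary `N`. A map on a relatively
open subset of the half-space is smooth if it extends smoothly to an open set `V` of the
whole space, and `φ` is such an extension. -/
structure IsBoundaryParam {F : Type*} [NormedAddCommGroup F] [NormedSpace ℝ F]
    (N : Set F) (p : F) {k : ℕ} (φ : ℝ × EuclideanSpace ℝ (Fin k) → F)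
    (V : Set (ℝ × EuclideanSpace ℝ (Fin k))) : Prop where
  isOpen : IsOpen V
  zero_mem : 0 ∈ V
  map_zero : φ 0 = p
  smooth : ContDiffOn ℝ ∞ φ V
  immersion : ∀ v ∈ V ∩ halfSpace k, Function.Injective (fderiv ℝ φ v)
  embedding : IsEmbedding ((V ∩ halfSpace k).domRestrict φ)
  image : ∃ U : Set F, IsOpen U ∧ φ '' (V ∩ halfSpace k) = N ∩ U

/-! ### Spherical blow-up and strict transform -/

/-- The spherical blow-up `[ℝⁿ, a] = [0,∞) × S^{n-1}`, as a subset of `ℝ × ℝⁿ`. -/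
def blowUp (n : ℕ) : Set (ℝ × EuclideanSpace ℝ (Fin n)) := {q | 0 ≤ q.1 ∧ ‖q.2‖ = 1}

/-- The blowing-down map `(r, u) ↦ r u + a`. -/
def blowDown {n : ℕ} (a : EuclideanSpace ℝ (Fin n)) (q : ℝ × EuclideanSpace ℝ (Fin n)) :
    EuclideanSpace ℝ (Fin n) :=
  q.1 • q.2 + a

/-- The strict transform `[S, a]`: the closure in the blow-up of the preimage of `S \ {a}`. As the
blow-up is closed in `ℝ × ℝⁿ`, this is the closure in `ℝ × ℝⁿ`. -/
def strictTransform {n : ℕ} (S : Set (EuclideanSpace ℝ (Fin n))) (a : EuclideanSpace ℝ (Fin n)) :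
    Set (ℝ × EuclideanSpace ℝ (Fin n)) :=
  closure (blowUp n ∩ blowDown a ⁻¹' (S \ {a}))

/-- The tangent space of `[0,∞) × S^{n-1}` at `(t, u)`. -/
def tangentBlowUp {n : ℕ} (u : EuclideanSpace ℝ (Fin n)) :
    Submodule ℝ (ℝ × EuclideanSpace ℝ (Fin n)) :=
  (⊤ : Submodule ℝ ℝ).prod (Submodule.span ℝ {u})ᗮ

/-- The tangent space of the boundary `0 × S^{n-1}` of `[0,∞) × S^{n-1}` at `(0, u)`. -/
def tangentFrontFace {n : ℕ} (u : EuclideanSpace ℝ (Fin n)) :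
    Submodule ℝ (ℝ × EuclideanSpace ℝ (Fin n)) :=
  (⊥ : Submodule ℝ ℝ).prod (Submodule.span ℝ {u})ᗮ

/-- `N` is a p-submanifold of (an open subset of) the blow-up `[0,∞) × S^{n-1}`: a smooth embedded
submanifold with boundary, the boundary of `N` is the part of `N` that lies in the boundary
`0 × S^{n-1}`, and there `N` is transverse to `0 × S^{n-1}`. The connected components of `N` may have
different dimensions. As `[0,∞) × S^{n-1}` is an embedded submanifold with boundary of `ℝ × ℝⁿ`,
smoothness, immersions and embeddings may be tested in `ℝ × ℝⁿ`. The tangent space of `N` at a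
boundary point is the range of the derivative of a parametrization. -/
structure IsPSubmanifold {n : ℕ} (N : Set (ℝ × EuclideanSpace ℝ (Fin n))) : Prop where
  subset : N ⊆ blowUp n
  interior : ∀ p ∈ N, 0 < p.1 → IsSmoothAt N p
  boundary : ∀ p ∈ N, p.1 = 0 →
    ∃ (k : ℕ) (φ : ℝ × EuclideanSpace ℝ (Fin k) → ℝ × EuclideanSpace ℝ (Fin n))
      (V : Set (ℝ × EuclideanSpace ℝ (Fin k))),
      IsBoundaryParam N p φ V ∧
        LinearMap.range (fderiv ℝ φ 0).toLinearMap ⊔ tangentFrontFace p.2 = tangentBlowUp p.2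

/-! ### Conic points -/

/-- `a` is a conic point of `X ⊆ ℝⁿ`: the germ of `X` at `a` is non-empty and closed (that is, `a ∈ X`
and `X` agrees with a closed set near `a`), and for some `r > 0` the strict transform of
`X ∩ {|x - a| < r}` at `a` is a p-submanifold of `[0,r) × S^{n-1}`, in which it is closed. -/
def IsConicPoint {n : ℕ} (X : Set (EuclideanSpace ℝ (Fin n))) (a : EuclideanSpace ℝ (Fin n)) :
    Prop :=
  a ∈ X ∧ (∃ C U : Set (EuclideanSpace ℝ (Fin n)), IsClosed C ∧ IsOpen U ∧ a ∈ U ∧ X ∩ U = C ∩ U) ∧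
    ∃ r : ℝ, 0 < r ∧
      IsPSubmanifold (strictTransform (X ∩ Metric.ball a r) a ∩ {q | q.1 < r})

section Manifold

variable {n : ℕ} {M : Type*} [TopologicalSpace M] [ChartedSpace (EuclideanSpace ℝ (Fin n)) M]

/-- `ψ` is a smooth chart of `M` centred at `z` whose image is the open unit ball of `ℝⁿ`. -/
structure IsBallChart (z : M) (ψ : OpenPartialHomeomorph M (EuclideanSpace ℝ (Fin n))) : Prop where
  mem_atlas : ψ ∈ IsManifold.maximalAtlas (𝓡 n) ∞ M
  mem_source : z ∈ ψ.source
  centred : ψ z = 0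
  target : ψ.target = Metric.ball 0 1

/-- The subset `Z` of the manifold `M` is conic at `z`: it is so in a smooth chart at `z`. -/
def IsConicAt (n : ℕ) {M : Type*} [TopologicalSpace M] [ChartedSpace (EuclideanSpace ℝ (Fin n)) M]
    (Z : Set M) (z : M) : Prop :=
  ∃ ψ : OpenPartialHomeomorph M (EuclideanSpace ℝ (Fin n)),
    IsBallChart z ψ ∧ IsConicPoint (ψ '' (Z ∩ ψ.source)) (ψ z)

/-- The singular locus of `Z ⊆ M`: the points of `Z` at which the germ of `Z` is not that of a smooth
submanifold of `M`. -/
def singularLocus (n : ℕ) {M : Type*} [TopologicalSpace M]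
    [ChartedSpace (EuclideanSpace ℝ (Fin n)) M] (Z : Set M) : Set M :=
  {z | z ∈ Z ∧ ¬ ∃ ψ : OpenPartialHomeomorph M (EuclideanSpace ℝ (Fin n)),
    IsBallChart z ψ ∧ IsSmoothAt (ψ '' (Z ∩ ψ.source)) (ψ z)}

/-- `W` is a conic singular submanifold of the `n`-dimensional smooth manifold `M`. -/
structure IsConicSingularSubmanifold (n : ℕ) {M : Type*} [TopologicalSpace M]
    [ChartedSpace (EuclideanSpace ℝ (Fin n)) M] (W : Set M) : Prop where
  isClosed : IsClosed W
  conic : ∀ z ∈ W, IsConicAt n W z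
  finite_singularLocus : (singularLocus n W).Finite

end Manifold

end ConicLNE

end

/-! For a compact connected set the question is local. Suppose that near every point of `W` the
inner distance is at most a multiple of the outer one. Then inner distances to nearby points are
finite, connectedness makes all of them finite, and off the diagonal the outer distance is bounded
below; compactness of `W × W` yields a single constant (`isLNE_of_locally`). Smooth charts of a
Riemannian manifold are locally bi-Lipschitz, so the local estimate only has to be proved in `ℝⁿ`,
at a conic point `a`.

There one works on the strict transform `N`. For `r, r' ≥ 0` and unit vectors `u, u'`, the distance
from `ru + a` to `r'u' + a` is comparable to `|r - r'| + r|u - u'|`. Because `N` meets the front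
face `r = 0` exactly in its boundary and transversally, near each boundary point it has a
bi-Lipschitz parametrization by a half ball whose first coordinate is the radius
(`IsPSubmanifold.exists_collar`). A segment of the half ball then blows down to a path whose length
is at most a multiple of the outer distance of its ends (`innerEDist_blowDown_le`); segments with
constant second coordinate reach `a` itself. Two points in well separated directions are joined
through `a`, since their outer distance is at least a multiple of both radii.

Finally, the link, that is the part of `N` in the front face, is compact. So finitely many such
estimates cover all pairs of points of `N` of small radius (`IsConicPoint.exists_innerEDist_le`). -/

namespace ConicLNE

/-! ### Preferred charts of a Riemannian manifold are locally bi-Lipschitz. -/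

section RiemannianCharts

open Metric MeasureTheory Filter Manifold

variable {E : Type*} [NormedAddCommGroup E] [NormedSpace ℝ E]
  {H : Type*} [TopologicalSpace H] (I : ModelWithCorners ℝ E H)
  {M : Type*} [PseudoEMetricSpace M] [ChartedSpace H M]
  [RiemannianBundle (fun (x : M) ↦ TangentSpace I x)]
  [IsManifold I 1 M] [IsContinuousRiemannianBundle E (fun (x : M) ↦ TangentSpace I x)]
  [IsRiemannianManifold I M]

attribute [local instance] normedAddCommGroupTangentSpaceVectorSpace
attribute [local instance] normedSpaceTangentSpaceVectorSpace

/-- Near any point, the preferred extended chart of a Riemannian manifold is Lipschitz. -/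
theorem exists_lipschitzOnWith_extChartAt (x : M) :
    ∃ C : ℝ≥0, ∃ s ∈ 𝓝 x, LipschitzOnWith C (extChartAt I x) s := by
  obtain ⟨C, C_pos, hC⟩ : ∃ C > (0 : ℝ≥0), ∀ᶠ y in 𝓝 x,
      ∀ v : TangentSpace I y, ‖mfderiv% (extChartAt I x) y v‖ₑ ≤ C * ‖v‖ₑ := by
    rcases eventually_enorm_mfderiv_extChartAt_lt I x with ⟨C, C_pos, hC⟩
    refine ⟨C, C_pos, hC.mono fun y hy v ↦ ?_⟩
    apply (ContinuousLinearMap.le_opENorm _ _).trans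
    gcongr
    exact hy.le
  obtain ⟨c, c_pos, hc⟩ := EMetric.mem_nhds_iff.1
    (Filter.inter_mem hC (extChartAt_source_mem_nhds (I := I) x))
  -- Two points of the ball of radius `c / 3` are less than `2c / 3` apart, so a nearly shortest
  -- path between them stays in the ball of radius `c`, where the derivative bound holds.
  have c3 : 0 < c / 3 := ENNReal.div_pos c_pos.ne' (by simp)
  refine ⟨C, eball x (c / 3), Metric.eball_mem_nhds x c3, ?_⟩
  intro y hy y' hy'
  have hC0 : (C : ℝ≥0∞) ≠ 0 := by exact_mod_cast C_pos.ne'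
  have hyy : edist y y' < c / 3 + c / 3 := by
    calc edist y y' ≤ edist y x + edist x y' := edist_triangle _ _ _
      _ < c / 3 + c / 3 := ENNReal.add_lt_add hy (by rw [edist_comm]; exact hy')
  rw [mul_comm, ← ENNReal.div_le_iff_le_mul (Or.inl hC0) (Or.inl ENNReal.coe_ne_top)]
  -- Shortest paths need not exist, so the bound is proved for every `d` above the distance; only
  -- `d` up to `2c / 3` matters, which keeps the path inside the ball.
  refine le_of_forall_gt_imp_ge_of_dense fun d hd ↦ ?_
  wlog hd' : d ≤ c / 3 + c / 3 generalizing d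
  · exact (this _ hyy le_rfl).trans (not_le.1 hd').le
  rw [ENNReal.div_le_iff_le_mul (Or.inl hC0) (Or.inl ENNReal.coe_ne_top)]
  rw [IsRiemannianManifold.out (I := I) y y'] at hd
  rcases exists_lt_locally_constant_of_riemannianEDist_lt hd zero_lt_one
    with ⟨γ, hγx, hγy, γ_smooth, hγ, -⟩
  have hmem : ∀ t ∈ Icc (0 : ℝ) 1, γ t ∈ {y | ∀ v : TangentSpace I y, ‖mfderiv% (extChartAt I x) y v‖ₑ ≤ C * ‖v‖ₑ} ∩
      (extChartAt I x).source := by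
    intro t ht
    apply hc
    have h1 : edist y (γ t) ≤ pathELength I γ 0 1 := by
      rw [IsRiemannianManifold.out (I := I) y (γ t)]
      exact (riemannianEDist_le_pathELength γ_smooth.contMDiffOn hγx rfl ht.1).trans
        (pathELength_mono le_rfl ht.2)
    calc edist (γ t) x ≤ edist (γ t) y + edist y x := edist_triangle _ _ _
      _ < (c / 3 + c / 3) + c / 3 := by
        refine ENNReal.add_lt_add ?_ hy
        rw [edist_comm]
        exact (h1.trans_lt hγ).trans_le hd'
      _ = c := ENNReal.add_thirds c
  have uc : ∀ t ∈ Icc (0 : ℝ) 1, γ t ∈ (chartAt H x).source := fun t ht ↦ by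
    simpa [extChartAt_source] using (hmem t ht).2
  let γ' := extChartAt I x ∘ γ
  have hγ' : CMDiff[Icc 0 1] 1 γ' :=
    contMDiffOn_extChartAt.comp (I' := I) (t := (chartAt H x).source)
      γ_smooth.contMDiffOn (fun t' ht' ↦ uc t' ht')
  calc
    edist (extChartAt I x y) (extChartAt I x y') = ‖γ' 1 - γ' 0‖ₑ := by
      rw [edist_comm, edist_eq_enorm_sub]; simp [γ', hγx, hγy]
    _ ≤ ∫⁻ t' in Icc 0 1, ‖derivWithin γ' (Icc 0 1) t'‖ₑ := by
      apply enorm_sub_le_lintegral_derivWithin_Icc_of_contDiffOn_Icc _ zero_le_one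
      rwa [← contMDiffOn_iff_contDiffOn]
    _ = ∫⁻ t' in Icc 0 1, ‖mfderiv[Icc 0 1] γ' t' 1‖ₑ := by
      simp_rw [← fderivWithin_derivWithin, mfderivWithin_eq_fderivWithin]
      rfl
    _ ≤ ∫⁻ t' in Icc 0 1, C * ‖mfderiv[Icc 0 1] γ t' 1‖ₑ := by
      apply setLIntegral_mono' measurableSet_Icc (fun t' ht' ↦ ?_)
      have : mfderiv[Icc 0 1] γ' t' =
          (mfderiv% (extChartAt I x) (γ t')) ∘L (mfderiv[Icc 0 1] γ t') := by
        apply mfderiv_comp_mfderivWithin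
        · exact mdifferentiableAt_extChartAt (uc _ ht')
        · exact (γ_smooth.mdifferentiable one_ne_zero).mdifferentiableOn _ ht'
        · rw [uniqueMDiffWithinAt_iff_uniqueDiffWithinAt]
          exact uniqueDiffOn_Icc zero_lt_one _ ht'
      have : mfderiv[Icc 0 1] γ' t' 1 =
          (mfderiv% (extChartAt I x) (γ t')) (mfderiv[Icc 0 1] γ t' 1) :=
        DFunLike.congr_fun this 1
      rw [this]
      exact (hmem t' ht').1 _
    _ = C * pathELength I γ 0 1 := by
      rw [lintegral_const_mul' _ _ ENNReal.coe_ne_top,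
          pathELength_eq_lintegral_mfderivWithin_Icc]
    _ ≤ d * C := by rw [mul_comm]; gcongr

/-- Near any point, the inverse of the preferred extended chart of a Riemannian manifold is
Lipschitz. -/
theorem exists_edist_le_edist_extChartAt (x : M) :
    ∃ C : ℝ≥0, ∃ s ∈ 𝓝 x, ∀ y ∈ s, ∀ y' ∈ s,
      edist y y' ≤ C * edist (extChartAt I x y) (extChartAt I x y') := by
  obtain ⟨C, C_pos, hC⟩ : ∃ C > (0 : ℝ≥0), ∀ᶠ y in 𝓝[range I] (extChartAt I x x),
      ∀ v : TangentSpace 𝓘(ℝ, E) y, ‖mfderiv[range I] (extChartAt I x).symm y v‖ₑ ≤ C * ‖v‖ₑ := by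
    rcases eventually_enorm_mfderivWithin_symm_extChartAt_lt I x with ⟨C, C_pos, hC⟩
    refine ⟨C, C_pos, hC.mono fun y hy v ↦ ?_⟩
    apply (ContinuousLinearMap.le_opENorm _ _).trans
    gcongr
    exact hy.le
  obtain ⟨r, r_pos, hr⟩ : ∃ r > 0,
      ball (extChartAt I x x) r ∩ range I ⊆ (extChartAt I x).target ∩
        {y | ∀ v : TangentSpace 𝓘(ℝ, E) y, ‖mfderiv[range I] (extChartAt I x).symm y v‖ₑ ≤ C * ‖v‖ₑ} :=
    mem_nhdsWithin_iff.1 (inter_mem (extChartAt_target_mem_nhdsWithin x) hC)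
  have A : (extChartAt I x) ⁻¹' (ball (extChartAt I x x) r ∩ range I) ∈ 𝓝 x := by
    apply extChartAt_preimage_mem_nhds_of_mem_nhdsWithin (by simp)
    rw [inter_comm]
    exact inter_mem_nhdsWithin _ (ball_mem_nhds _ r_pos)
  refine ⟨C, _, inter_mem A (chart_source_mem_nhds H x), ?_⟩
  rintro y ⟨hy, h'y⟩ z ⟨hz, h'z⟩
  -- The competitor path is the straight segment in the chart; it stays in the good region because
  -- balls and `range I` are convex.
  let η := ContinuousAffineMap.lineMap (R := ℝ) (extChartAt I x y) (extChartAt I x z)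
  set γ := (extChartAt I x).symm ∘ η
  have hη : Icc 0 1 ⊆ ⇑η ⁻¹' ((extChartAt I x).target ∩
        {y | ∀ v : TangentSpace 𝓘(ℝ, E) y, ‖mfderiv[range I] (extChartAt I x).symm y v‖ₑ ≤ C * ‖v‖ₑ}) := by
    simp only [← image_subset_iff, ContinuousAffineMap.coe_lineMap_eq,
     ← segment_eq_image_lineMap, η]
    apply Subset.trans _ hr
    exact ((convex_ball _ _).inter I.convex_range).segment_subset hy hz
  simp only [preimage_inter, subset_inter_iff] at hη
  have η_smooth : CMDiff[Icc 0 1] 1 η := by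
    apply ContMDiff.contMDiffOn
    rw [contMDiff_iff_contDiff]
    exact ContinuousAffineMap.contDiff _
  have : edist y z ≤ pathELength I γ 0 1 := by
    rw [IsRiemannianManifold.out (I := I) y z]
    apply riemannianEDist_le_pathELength _ _ _ zero_le_one
    · exact (contMDiffOn_extChartAt_symm x).comp η_smooth hη.1
    · simp [γ, η, ContinuousAffineMap.coe_lineMap_eq, h'y]
    · simp [γ, η, ContinuousAffineMap.coe_lineMap_eq, h'z]
  apply this.trans
  rw [← lintegral_fderiv_lineMap_eq_edist, pathELength_eq_lintegral_mfderivWithin_Icc,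
    ← lintegral_const_mul' _ _ ENNReal.coe_ne_top]
  apply setLIntegral_mono' measurableSet_Icc (fun t ht ↦ ?_)
  have : mfderiv[Icc 0 1] γ t =
      (mfderiv[range I] (extChartAt I x).symm (η t)) ∘L (mfderiv[Icc 0 1] η t) := by
    apply mfderivWithin_comp
    · exact mdifferentiableWithinAt_extChartAt_symm (hη.1 ht)
    · exact η_smooth.mdifferentiableOn one_ne_zero t ht
    · exact hη.1.trans (preimage_mono (extChartAt_target_subset_range x))
    · rw [uniqueMDiffWithinAt_iff_uniqueDiffWithinAt]
      exact uniqueDiffOn_Icc zero_lt_one t ht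
  have : mfderiv[Icc 0 1] γ t 1 =
      (mfderiv[range I] (extChartAt I x).symm (η t)) (mfderiv[Icc 0 1] η t 1) :=
    DFunLike.congr_fun this 1
  rw [this]
  apply (hη.2 ht _).trans
  gcongr
  · simp only [mfderivWithin_eq_fderivWithin]
    exact le_of_eq rfl

end RiemannianCharts

/-! ### Arbitrary smooth charts are locally bi-Lipschitz. -/

section Charts

variable {n : ℕ} {M : Type*} [PseudoEMetricSpace M]
  [ChartedSpace (EuclideanSpace ℝ (Fin n)) M] [IsManifold (𝓡 n) ∞ M]
  [RiemannianBundle (fun x : M => TangentSpace (𝓡 n) x)]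
  [IsContMDiffRiemannianBundle (𝓡 n) ∞ (EuclideanSpace ℝ (Fin n))
    (fun x : M => TangentSpace (𝓡 n) x)]

variable (n M) in
theorem isContinuousRiemannianBundle_tangentSpace :
    IsContinuousRiemannianBundle (EuclideanSpace ℝ (Fin n))
      (fun x : M => TangentSpace (𝓡 n) x) := by
  obtain ⟨g, hg, h⟩ := IsContMDiffRiemannianBundle.exists_contMDiff (IB := 𝓡 n) (n := ∞)
    (F := EuclideanSpace ℝ (Fin n)) (E := fun x : M => TangentSpace (𝓡 n) x)
  exact ⟨g, hg.continuous, h⟩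

variable [IsRiemannianManifold (𝓡 n) M]

/-- A smooth chart of a Riemannian manifold is Lipschitz near every point of its source. -/
theorem exists_lipschitzOnWith_chart {ψ : OpenPartialHomeomorph M (EuclideanSpace ℝ (Fin n))}
    (hψ : ψ ∈ IsManifold.maximalAtlas (𝓡 n) ∞ M) {z : M} (hz : z ∈ ψ.source) :
    ∃ C : ℝ≥0, ∃ s ∈ 𝓝 z, LipschitzOnWith C ψ s := by
  have := isContinuousRiemannianBundle_tangentSpace n M
  obtain ⟨C, s, hs, hC⟩ := exists_lipschitzOnWith_extChartAt (𝓡 n) z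
  have h1 : ContMDiffAt (𝓡 n) (𝓡 n) ∞ ψ ((extChartAt (𝓡 n) z).symm (extChartAt (𝓡 n) z z)) := by
    rw [extChartAt_to_inv]
    exact (contMDiffOn_of_mem_maximalAtlas hψ).contMDiffAt (ψ.open_source.mem_nhds hz)
  have h2 : ContMDiffAt (𝓡 n) (𝓡 n) ∞ (extChartAt (𝓡 n) z).symm (extChartAt (𝓡 n) z z) :=
    (contMDiffOn_extChartAt_symm z).contMDiffAt (extChartAt_target_mem_nhds z)
  -- The change of charts is smooth between open sets of `ℝⁿ`, hence locally Lipschitz, and the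
  -- preferred chart is already known to be so.
  have h3 : ContDiffAt ℝ ∞ (ψ ∘ (extChartAt (𝓡 n) z).symm) (extChartAt (𝓡 n) z z) :=
    (h1.comp _ h2).contDiffAt
  obtain ⟨K, t, ht, hK⟩ := (h3.of_le (m := 1) (by simp)).exists_lipschitzOnWith
  refine ⟨K * C, s ∩ extChartAt (𝓡 n) z ⁻¹' t ∩ (extChartAt (𝓡 n) z).source,
    Filter.inter_mem (Filter.inter_mem hs ((continuousAt_extChartAt z).preimage_mem_nhds ht))
      (extChartAt_source_mem_nhds z), ?_⟩
  have h4 : LipschitzOnWith (K * C) ((ψ ∘ (extChartAt (𝓡 n) z).symm) ∘ extChartAt (𝓡 n) z)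
      (s ∩ extChartAt (𝓡 n) z ⁻¹' t ∩ (extChartAt (𝓡 n) z).source) :=
    hK.comp (hC.mono fun x hx ↦ hx.1.1) fun x hx ↦ hx.1.2
  intro x hx y hy
  have := h4 hx hy
  simp only [Function.comp_apply] at this
  rwa [(extChartAt (𝓡 n) z).left_inv hx.2, (extChartAt (𝓡 n) z).left_inv hy.2] at this

/-- The inverse of a smooth chart of a Riemannian manifold is locally Lipschitz. -/
theorem exists_lipschitzOnWith_chart_symm {ψ : OpenPartialHomeomorph M (EuclideanSpace ℝ (Fin n))}
    (hψ : ψ ∈ IsManifold.maximalAtlas (𝓡 n) ∞ M) {z : M} (hz : z ∈ ψ.source) :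
    ∃ C : ℝ≥0, ∃ s ∈ 𝓝 (ψ z), LipschitzOnWith C ψ.symm s := by
  have := isContinuousRiemannianBundle_tangentSpace n M
  obtain ⟨C, s, hs, hC⟩ := exists_edist_le_edist_extChartAt (𝓡 n) z
  have h1 : ContMDiffAt (𝓡 n) (𝓡 n) ∞ (extChartAt (𝓡 n) z) (ψ.symm (ψ z)) := by
    rw [ψ.left_inv hz]
    exact contMDiffAt_extChartAt
  have h2 : ContMDiffAt (𝓡 n) (𝓡 n) ∞ ψ.symm (ψ z) :=
    (contMDiffOn_symm_of_mem_maximalAtlas hψ).contMDiffAt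
      (ψ.open_target.mem_nhds (ψ.map_source hz))
  have h3 : ContDiffAt ℝ ∞ (extChartAt (𝓡 n) z ∘ ψ.symm) (ψ z) :=
    (h1.comp _ h2).contDiffAt
  obtain ⟨K, t, ht, hK⟩ := (h3.of_le (m := 1) (by simp)).exists_lipschitzOnWith
  have h5 : ψ.symm ⁻¹' s ∈ 𝓝 (ψ z) := by
    refine (ψ.continuousAt_symm (ψ.map_source hz)).preimage_mem_nhds ?_
    rwa [ψ.left_inv hz]
  refine ⟨C * K, t ∩ ψ.symm ⁻¹' s, Filter.inter_mem ht h5, fun x hx y hy ↦ ?_⟩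
  calc edist (ψ.symm x) (ψ.symm y) ≤ C * (K * edist x y) :=
        (hC _ hx.2 _ hy.2).trans (by gcongr; exact hK hx.1 hy.1)
    _ = _ := by rw [← mul_assoc, ENNReal.coe_mul]

end Charts

/-! ### Inner distance, and reduction to a local estimate. -/

section InnerDistance

variable {M : Type*} [PseudoEMetricSpace M]

/-- The identity has variation `1` on the unit interval, and a `C`-Lipschitz map multiplies
variation by at most `C`. Explicit paths are measured through this bound. -/
theorem innerEDist_le_of_lipschitzOnWith {S : Set M} {γ : ℝ → M} {C : ℝ≥0}
    (hγ : LipschitzOnWith C γ (Icc 0 1)) (hS : MapsTo γ (Icc 0 1) S) :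
    innerEDist S (γ 0) (γ 1) ≤ C := by
  refine (iInf₂_le γ ⟨hγ.continuousOn, fun t ht ↦ hS ht, rfl, rfl⟩).trans ?_
  have h := hγ.comp_eVariationOn_le (g := id) (mapsTo_id _)
  have h1 : eVariationOn (id : ℝ → ℝ) (Icc 0 1) ≤ 1 := by
    have := (monotoneOn_id (s := Icc (0 : ℝ) 1)).eVariationOn_eq (a := 0) (b := 1)
      (by simp) (by simp)
    simp_all
  calc eVariationOn γ (Icc 0 1) ≤ C * eVariationOn (id : ℝ → ℝ) (Icc 0 1) := h
    _ ≤ C * 1 := by gcongr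
    _ = C := mul_one _

theorem innerEDist_self {S : Set M} {x : M} (hx : x ∈ S) : innerEDist S x x = 0 := by
  have := innerEDist_le_of_lipschitzOnWith (S := S) (γ := fun _ ↦ x) (C := 0)
    (LipschitzWith.const x).lipschitzOnWith (fun _ _ ↦ hx)
  simpa using this

theorem innerEDist_map_le {N : Type*} [PseudoEMetricSpace N] {S : Set M} {T : Set N} {f : M → N}
    {K : ℝ≥0} (hK : K ≠ 0) (hf : LipschitzOnWith K f S) (hT : MapsTo f S T) (x y : M) :
    innerEDist T (f x) (f y) ≤ K * innerEDist S x y := by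
  have hK' : (K : ℝ≥0∞) ≠ 0 := by exact_mod_cast hK
  -- Where there is no path the infimum is `∞`, and `0 * ∞ = 0`; hence the need for `K ≠ 0`.
  simp only [innerEDist, ENNReal.mul_iInf_of_ne hK' ENNReal.coe_ne_top]
  refine le_iInf₂ fun γ hγ ↦ (iInf₂_le (f ∘ γ) ⟨hf.continuousOn.comp hγ.1 hγ.2.1,
    fun t ht ↦ hT (hγ.2.1 t ht), by simp [hγ.2.2.1], by simp [hγ.2.2.2]⟩).trans ?_
  exact hf.comp_eVariationOn_le hγ.2.1

theorem innerEDist_comm_le (S : Set M) (x y : M) : innerEDist S y x ≤ innerEDist S x y := by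
  refine le_iInf₂ fun γ hγ ↦ ?_
  have hm : MapsTo (fun t : ℝ ↦ 1 - t) (Icc 0 1) (Icc 0 1) := fun t ht ↦
    ⟨by linarith [ht.2], by linarith [ht.1]⟩
  refine (iInf₂_le (γ ∘ fun t ↦ 1 - t) ⟨hγ.1.comp (by fun_prop) hm, fun t ht ↦ hγ.2.1 _ (hm ht),
    by simp [hγ.2.2.2], by simp [hγ.2.2.1]⟩).trans ?_
  exact eVariationOn.comp_le_of_antitoneOn _ _ (fun s _ t _ h ↦ by linarith) hm

theorem innerEDist_comm (S : Set M) (x y : M) : innerEDist S x y = innerEDist S y x :=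
  (innerEDist_comm_le S y x).antisymm (innerEDist_comm_le S x y)

theorem IsPathIn.trans {S : Set M} {x y z : M} {γ δ : ℝ → M} (hγ : IsPathIn S x y γ)
    (hδ : IsPathIn S y z δ) :
    ∃ ε, IsPathIn S x z ε ∧
      eVariationOn ε (Icc 0 1) ≤ eVariationOn γ (Icc 0 1) + eVariationOn δ (Icc 0 1) := by
  let ε : ℝ → M := fun t ↦ if t ≤ 1 / 2 then γ (2 * t) else δ (2 * t - 1)
  have h1 : EqOn ε (γ ∘ fun t ↦ 2 * t) (Icc 0 (1 / 2)) := fun t ht ↦ by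
    simp only [ε, if_pos ht.2, Function.comp_apply]
  have h2 : EqOn ε (δ ∘ fun t ↦ 2 * t - 1) (Icc (1 / 2) 1) := fun t ht ↦ by
    rcases ht.1.eq_or_lt with rfl | h
    · simp [ε, hγ.2.2.2, hδ.2.2.1]
    · simp only [ε, if_neg h.not_ge, Function.comp_apply]
  have m1 : MapsTo (fun t : ℝ ↦ 2 * t) (Icc 0 (1 / 2)) (Icc 0 1) := fun t ht ↦
    ⟨by linarith [ht.1], by linarith [ht.2]⟩
  have m2 : MapsTo (fun t : ℝ ↦ 2 * t - 1) (Icc (1 / 2) 1) (Icc 0 1) := fun t ht ↦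
    ⟨by linarith [ht.1], by linarith [ht.2]⟩
  have hI : Icc (0 : ℝ) 1 = Icc 0 (1 / 2) ∪ Icc (1 / 2) 1 :=
    (Icc_union_Icc_eq_Icc (by norm_num) (by norm_num)).symm
  refine ⟨ε, ⟨?_, ?_, ?_, ?_⟩, ?_⟩
  · rw [hI]
    exact ((hγ.1.comp (by fun_prop) m1).congr h1).union_of_isClosed
      ((hδ.1.comp (by fun_prop) m2).congr h2) isClosed_Icc isClosed_Icc
  · rw [hI]
    rintro t (ht | ht)
    · rw [h1 ht]; exact hγ.2.1 _ (m1 ht)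
    · rw [h2 ht]; exact hδ.2.1 _ (m2 ht)
  · rw [h1 (by norm_num)]; simp [hγ.2.2.1]
  · rw [h2 (by norm_num)]; norm_num [hδ.2.2.2]
  · have := eVariationOn.Icc_add_Icc ε (s := univ) (a := 0) (b := 1 / 2) (c := 1) (by norm_num)
      (by norm_num) (mem_univ _)
    simp only [univ_inter] at this
    rw [← this, eVariationOn.congr h1, eVariationOn.congr h2]
    exact add_le_add
      (eVariationOn.comp_le_of_monotoneOn _ _ (fun s _ t _ h ↦ by linarith) m1)
      (eVariationOn.comp_le_of_monotoneOn _ _ (fun s _ t _ h ↦ by linarith) m2)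

theorem innerEDist_triangle (S : Set M) (x y z : M) :
    innerEDist S x z ≤ innerEDist S x y + innerEDist S y z := by
  simp only [innerEDist, ENNReal.add_iInf, ENNReal.iInf_add]
  refine le_iInf₂ fun δ hδ ↦ le_iInf₂ fun γ hγ ↦ ?_
  obtain ⟨ε, hε, h⟩ := hγ.trans hδ
  exact (iInf₂_le ε hε).trans h

/-- A bound that holds locally near each point of a compact set holds uniformly near it. -/
theorem _root_.IsCompact.exists_forall_eventually_nhdsSet {X : Type*} [TopologicalSpace X]
    {K : Set X} (hK : IsCompact K) {P : ℝ≥0 → X → Prop}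
    (mono : ∀ x a b, a ≤ b → P a x → P b x)
    (h : ∀ x ∈ K, ∃ a, ∀ᶠ y in 𝓝 x, P a y) : ∃ a, ∀ᶠ y in 𝓝ˢ K, P a y := by
  refine hK.induction_on (p := fun s ↦ ∃ a, ∀ᶠ y in 𝓝ˢ s, P a y) ⟨0, by simp⟩
    (fun s t hst ⟨a, ha⟩ ↦ ⟨a, ha.filter_mono (nhdsSet_mono hst)⟩) ?_ fun x hx ↦ ?_
  · rintro s t ⟨a, ha⟩ ⟨b, hb⟩
    refine ⟨max a b, ?_⟩
    rw [nhdsSet_union, Filter.eventually_sup]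
    exact ⟨ha.mono fun y hy ↦ mono y _ _ (le_max_left _ _) hy,
      hb.mono fun y hy ↦ mono y _ _ (le_max_right _ _) hy⟩
  · obtain ⟨a, ha⟩ := h x hx
    refine ⟨interior {y | P a y}, mem_nhdsWithin_of_mem_nhds (interior_mem_nhds.2 ha), a, ?_⟩
    rw [isOpen_interior.nhdsSet_eq]
    exact interior_subset

/-- A compact preconnected set whose inner distance is locally bounded by a multiple of the outer
distance is Lipschitz normally embedded. -/
theorem isLNE_of_locally {M : Type*} [EMetricSpace M] {W : Set M} (hW : IsCompact W)
    (hW' : IsPreconnected W) (h : ∀ z ∈ W, ∃ L : ℝ≥0, ∀ᶠ p in 𝓝 (z, z), p.1 ∈ W → p.2 ∈ W →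
      innerEDist W p.1 p.2 ≤ L * edist p.1 p.2) : IsLNE W := by
  have near : ∀ z ∈ W, ∃ D : ℝ≥0, ∀ᶠ y in 𝓝 z, y ∈ W → innerEDist W z y ≤ D := by
    intro z hz
    obtain ⟨L, hL⟩ := h z hz
    have h1 : ∀ᶠ y in 𝓝 z, edist z y ≤ 1 := by
      filter_upwards [Metric.eball_mem_nhds z one_pos] with y hy
      rw [edist_comm]
      exact hy.le
    refine ⟨L, ?_⟩
    filter_upwards [(Continuous.prodMk_right z).continuousAt.eventually hL, h1] with y hy h1 hyW
    calc innerEDist W z y ≤ L * edist z y := hy hz hyW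
      _ ≤ L * 1 := by gcongr
      _ = L := mul_one _
  -- Being at finite inner distance is an equivalence relation on `W` that holds near each point, so
  -- it holds throughout a preconnected set.
  have fin : ∀ x ∈ W, ∀ y ∈ W, innerEDist W x y < ⊤ := by
    intro x hx y hy
    refine hW'.induction₂ (fun x y ↦ innerEDist W x y < ⊤) (fun z hz ↦ ?_)
      (fun x y z _ _ _ h1 h2 ↦ (innerEDist_triangle W x y z).trans_lt (ENNReal.add_lt_top.2 ⟨h1, h2⟩))
      (fun x y _ _ h ↦ by rwa [innerEDist_comm]) hx hy
    obtain ⟨D, hD⟩ := near z hz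
    filter_upwards [mem_nhdsWithin_of_mem_nhds hD, self_mem_nhdsWithin] with y hy hyW
    exact (hy hyW).trans_lt ENNReal.coe_lt_top
  obtain ⟨L, hL⟩ := (hW.prod hW).exists_forall_eventually_nhdsSet
    (P := fun L p ↦ p.1 ∈ W → p.2 ∈ W → innerEDist W p.1 p.2 ≤ L * edist p.1 p.2)
    (fun p a b hab hp h1 h2 ↦ (hp h1 h2).trans (by gcongr)) (by
      rintro ⟨a, b⟩ ⟨ha, hb⟩
      dsimp only at ha hb
      by_cases hab : a = b
      · subst hab; exact h a ha
      obtain ⟨D, hD⟩ := near a ha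
      obtain ⟨D', hD'⟩ := near b hb
      lift innerEDist W a b to ℝ≥0 using (fin a ha b hb).ne with m hm
      obtain ⟨e, he0, he⟩ := ENNReal.lt_iff_exists_nnreal_btwn.1 (edist_pos.2 hab)
      have he0 : e ≠ 0 := by rintro rfl; simp at he0
      -- Off the diagonal, going through `a` and `b` bounds the inner distance by `D + m + D'`,
      -- while the outer distance stays above `e`.
      refine ⟨(D + m + D') / e, ?_⟩
      have hc : ∀ᶠ p : M × M in 𝓝 (a, b), (e : ℝ≥0∞) < edist p.1 p.2 :=
        (continuous_edist.tendsto (a, b)).eventually (lt_mem_nhds he)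
      have h1 : ∀ᶠ p : M × M in 𝓝 (a, b), p.1 ∈ W → innerEDist W a p.1 ≤ D :=
        (continuous_fst.tendsto (a, b)).eventually hD
      have h2 : ∀ᶠ p : M × M in 𝓝 (a, b), p.2 ∈ W → innerEDist W b p.2 ≤ D' :=
        (continuous_snd.tendsto (a, b)).eventually hD'
      filter_upwards [hc, h1, h2] with p hc h1 h2 hp1 hp2
      calc innerEDist W p.1 p.2 ≤ innerEDist W p.1 a + innerEDist W a b + innerEDist W b p.2 :=
            (innerEDist_triangle W _ b _).trans
              (by gcongr; exact innerEDist_triangle W _ a _)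
        _ ≤ D + m + D' := by
            rw [innerEDist_comm W p.1 a, ← hm]
            gcongr
            exacts [h1 hp1, h2 hp2]
        _ = ((D + m + D') / e : ℝ≥0) * (e : ℝ≥0∞) := by
            rw [← ENNReal.coe_mul, div_mul_cancel₀ _ he0]; push_cast; rfl
        _ ≤ _ := by gcongr)
  refine ⟨L + 1, by positivity, fun x hx y hy ↦ ?_⟩
  calc innerEDist W x y ≤ L * edist x y := hL.self_of_nhdsSet (x, y) ⟨hx, hy⟩ hx hy
    _ ≤ _ := by gcongr; exact le_self_add

end InnerDistance

/-! ### Local left inverses of immersions. -/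

section Immersions

variable {E F : Type*} [NormedAddCommGroup E] [NormedSpace ℝ E] [FiniteDimensional ℝ E]
  [NormedAddCommGroup F] [NormedSpace ℝ F] [FiniteDimensional ℝ F]

/-- A map with injective strict derivative has a strictly differentiable local left inverse. -/
theorem _root_.HasStrictFDerivAt.exists_leftInverse {φ : E → F} {φ' : E →L[ℝ] F} {x : E}
    (hφ : HasStrictFDerivAt φ φ' x) (hinj : Function.Injective φ') :
    ∃ (θ : F → E) (θ' : F →L[ℝ] E), HasStrictFDerivAt θ θ' (φ x) ∧
      (∀ᶠ y in 𝓝 x, θ (φ y) = y) ∧ ∀ u, θ' (φ' u) = u := by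
  have := FiniteDimensional.complete ℝ E
  -- With `A` a linear left inverse of the derivative, `A ∘ φ` has derivative the identity; its
  -- local inverse after `A` is the required map.
  obtain ⟨A, hA⟩ := φ'.toLinearMap.exists_leftInverse_of_injective
    (LinearMap.ker_eq_bot.2 hinj)
  let A' : F →L[ℝ] E := LinearMap.toContinuousLinearMap A
  have hA' : ∀ u, A' (φ' u) = u := fun u ↦ LinearMap.congr_fun hA u
  have h1 : HasStrictFDerivAt (A' ∘ φ) ((ContinuousLinearEquiv.refl ℝ E : E ≃L[ℝ] E) : E →L[ℝ] E)
      x := by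
    have h := A'.hasStrictFDerivAt.comp x hφ
    have e : A'.comp φ' = ((ContinuousLinearEquiv.refl ℝ E : E ≃L[ℝ] E) : E →L[ℝ] E) := by
      ext u; simp [hA']
    rwa [e] at h
  refine ⟨h1.localInverse _ _ _ ∘ A', A', ?_, h1.eventually_left_inverse, hA'⟩
  have h := h1.to_localInverse.comp (φ x) A'.hasStrictFDerivAt
  rwa [ContinuousLinearEquiv.refl_symm, ContinuousLinearEquiv.coe_refl,
    ContinuousLinearMap.id_comp] at h

/-- A map with injective strict derivative is locally expanding up to a constant. -/
theorem _root_.HasStrictFDerivAt.eventually_dist_le {φ : E → F} {φ' : E →L[ℝ] F} {x : E}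
    (hφ : HasStrictFDerivAt φ φ' x) (hinj : Function.Injective φ') :
    ∃ K : ℝ≥0, ∃ s ∈ 𝓝 x, ∀ y ∈ s, ∀ z ∈ s, dist y z ≤ K * dist (φ y) (φ z) := by
  obtain ⟨θ, θ', hθ, hleft, -⟩ := hφ.exists_leftInverse hinj
  obtain ⟨K, t, ht, hK⟩ := hθ.exists_lipschitzOnWith
  refine ⟨K, _, Filter.inter_mem (hφ.continuousAt.preimage_mem_nhds ht) hleft, ?_⟩
  rintro y ⟨hy, hy'⟩ z ⟨hz, hz'⟩
  have := hK.dist_le_mul _ hy _ hz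
  rwa [show θ (φ y) = y from hy', show θ (φ z) = z from hz'] at this

end Immersions

/-- Convergence can be lifted through an embedding of a subset. -/
theorem _root_.Topology.IsEmbedding.exists_tendsto_lift {X Y α : Type*} [TopologicalSpace X]
    [TopologicalSpace Y] {φ : X → Y} {V : Set X} (hφ : IsEmbedding (V.domRestrict φ)) {x : X}
    (hx : x ∈ V) {l : Filter α} {c : α → Y} (hc : Filter.Tendsto c l (𝓝 (φ x)))
    (hmem : ∀ᶠ t in l, c t ∈ φ '' V) :
    ∃ b : α → X, Filter.Tendsto b l (𝓝 x) ∧ ∀ᶠ t in l, b t ∈ V ∧ φ (b t) = c t := by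
  classical
  have hex : ∀ t, ∃ v : V, c t ∈ φ '' V → φ v = c t := fun t ↦ by
    by_cases h : c t ∈ φ '' V
    · obtain ⟨v, hv, h⟩ := h
      exact ⟨⟨v, hv⟩, fun _ ↦ h⟩
    · exact ⟨⟨x, hx⟩, fun h' ↦ absurd h' h⟩
  choose b hb using hex
  refine ⟨fun t ↦ b t, ?_, hmem.mono fun t ht ↦ ⟨(b t).2, hb t ht⟩⟩
  have : Filter.Tendsto b l (𝓝 ⟨x, hx⟩) := by
    rw [hφ.tendsto_nhds_iff]
    exact hc.congr' (hmem.mono fun t ht ↦ (hb t ht).symm)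
  exact (continuous_subtype_val.tendsto _).comp this

/-- A curve in the half-line leaving a boundary point has non-negative velocity. -/
theorem _root_.HasDerivWithinAt.nonneg_of_eventually_le {f : ℝ → ℝ} {f' : ℝ}
    (hf : HasDerivWithinAt f f' (Ici 0) 0) (h : ∀ᶠ t in 𝓝[≥] (0 : ℝ), f 0 ≤ f t) : 0 ≤ f' := by
  have h1 := (hasDerivWithinAt_iff_tendsto_slope' (by simp)).1 (hf.mono (Ioi_subset_Ici_self))
  refine ge_of_tendsto h1 ?_
  filter_upwards [h.filter_mono (nhdsWithin_mono _ Ioi_subset_Ici_self), self_mem_nhdsWithin]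
    with t ht ht0
  rw [slope_def_field]
  exact div_nonneg (by linarith) (by simpa using (mem_Ioi.1 ht0).le)

theorem zero_mem_halfSpace (k : ℕ) : 0 ∈ halfSpace k := le_refl (0 : ℝ)

/-! ### Smooth invariance of the boundary. -/

section BoundaryPoints

variable {F : Type*} [NormedAddCommGroup F] [NormedSpace ℝ F] {N : Set F} {k : ℕ}

theorem IsBoundaryParam.hasStrictFDerivAt {p : F} {φ : ℝ × EuclideanSpace ℝ (Fin k) → F}
    {V : Set (ℝ × EuclideanSpace ℝ (Fin k))} (h : IsBoundaryParam N p φ V)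
    {x : ℝ × EuclideanSpace ℝ (Fin k)} (hx : x ∈ V) : HasStrictFDerivAt φ (fderiv ℝ φ x) x :=
  (h.smooth.contDiffAt (h.isOpen.mem_nhds hx)).hasStrictFDerivAt (by simp)

theorem IsInteriorParam.hasStrictFDerivAt {p : F} {φ : EuclideanSpace ℝ (Fin k) → F}
    {V : Set (EuclideanSpace ℝ (Fin k))} (h : IsInteriorParam N p φ V)
    {x : EuclideanSpace ℝ (Fin k)} (hx : x ∈ V) : HasStrictFDerivAt φ (fderiv ℝ φ x) x :=
  (h.smooth.contDiffAt (h.isOpen.mem_nhds hx)).hasStrictFDerivAt (by simp)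

/-- Smooth invariance of the boundary: a boundary point of a submanifold with boundary is not an
interior point. -/
theorem IsBoundaryParam.not_isSmoothAt [FiniteDimensional ℝ F] {p : F}
    {φ : ℝ × EuclideanSpace ℝ (Fin k) → F}
    {V : Set (ℝ × EuclideanSpace ℝ (Fin k))} (h : IsBoundaryParam N p φ V)
    {x : ℝ × EuclideanSpace ℝ (Fin k)} (hx : x ∈ V) (hx0 : x.1 = 0) :
    ¬ IsSmoothAt N (φ x) := by
  -- At an interior point the velocities of curves in `N` are closed under negation. An inward curve
  -- would therefore have a counterpart with opposite velocity; read in the half-space, it would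
  -- start at the boundary with first coordinate of velocity `-1`.
  rintro ⟨m, χ, V', hχ⟩
  have hxH : x ∈ V ∩ halfSpace k := ⟨hx, hx0.ge⟩
  obtain ⟨U, hU, hUim⟩ := h.image
  obtain ⟨U', hU', hUim'⟩ := hχ.image
  have hqU : φ x ∈ U := (hUim.subset (mem_image_of_mem φ hxH)).2
  have hqN : φ x ∈ N := (hUim.subset (mem_image_of_mem φ hxH)).1
  have hqU' : φ x ∈ U' :=
    (hUim'.subset (hχ.map_zero ▸ mem_image_of_mem χ hχ.zero_mem)).2
  have hφ := h.hasStrictFDerivAt hx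
  have hχd := hχ.hasStrictFDerivAt hχ.zero_mem
  obtain ⟨θ, θ', hθ, hθl, hθ'⟩ := hφ.exists_leftInverse (h.immersion x hxH)
  obtain ⟨η, η', hη, hηl, hη'⟩ := hχd.exists_leftInverse (hχ.immersion 0 hχ.zero_mem)
  rw [hχ.map_zero] at hη
  set e : ℝ × EuclideanSpace ℝ (Fin k) := (1, 0)
  set w := fderiv ℝ φ x e
  -- the inward curve through the boundary point, read in the interior parametrization
  have hl : HasDerivAt (fun τ : ℝ ↦ x + τ • e) e 0 := by
    simpa using ((hasDerivAt_id (0 : ℝ)).smul_const e).const_add x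
  have hc : HasDerivAt (fun τ : ℝ ↦ φ (x + τ • e)) w 0 := by
    have : HasFDerivAt φ (fderiv ℝ φ x) (x + (0 : ℝ) • e) := by simpa using hφ.hasFDerivAt
    exact this.comp_hasDerivAt 0 hl
  have hct : Filter.Tendsto (fun τ : ℝ ↦ φ (x + τ • e)) (𝓝[≥] 0) (𝓝 (χ 0)) := by
    have := hc.continuousAt.tendsto
    simp only [zero_smul, add_zero] at this
    rw [hχ.map_zero]
    exact this.mono_left nhdsWithin_le_nhds
  have hcm : ∀ᶠ τ in 𝓝[≥] (0 : ℝ), φ (x + τ • e) ∈ χ '' V' := by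
    have h1 : ∀ᶠ τ in 𝓝 (0 : ℝ), x + τ • e ∈ V :=
      hl.continuousAt.eventually (by simpa using h.isOpen.mem_nhds hx)
    have h2 : ∀ᶠ τ in 𝓝 (0 : ℝ), φ (x + τ • e) ∈ U' :=
      hc.continuousAt.eventually (by simpa using hU'.mem_nhds hqU')
    filter_upwards [nhdsWithin_le_nhds h1, nhdsWithin_le_nhds h2, self_mem_nhdsWithin]
      with τ h1 h2 h3
    rw [hUim']
    refine ⟨(hUim.subset (mem_image_of_mem φ ⟨h1, ?_⟩)).1, h2⟩
    simpa [halfSpace, hx0, e] using h3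
  obtain ⟨b, hb, hbφ⟩ := hχ.embedding.exists_tendsto_lift hχ.zero_mem hct hcm
  -- The embedding only makes the lift `b` converge; it is differentiable because it agrees with the
  -- differentiable left inverse `η` along the curve.
  have hb' : HasDerivWithinAt b (η' w) (Ici 0) 0 := by
    have h1 : HasDerivWithinAt (fun τ : ℝ ↦ η (φ (x + τ • e))) (η' w) (Ici 0) 0 := by
      have : HasFDerivAt η η' (φ (x + (0 : ℝ) • e)) := by simpa using hη.hasFDerivAt
      exact (this.comp_hasDerivAt 0 hc).hasDerivWithinAt
    have h2 : b =ᶠ[𝓝[≥] 0] fun τ : ℝ ↦ η (φ (x + τ • e)) := by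
      filter_upwards [hb.eventually hηl, hbφ] with τ h1 h2
      rw [← h2.2, h1]
    exact h1.congr_of_eventuallyEq h2 (h2.self_of_nhdsWithin (by simp))
  -- The filter `𝓝[≥] 0` contains the point `0` itself, so the limit of `b` is its value there.
  have hb0 : b 0 = 0 := tendsto_nhds_unique_of_eventuallyEq (l := pure 0)
    (tendsto_pure_nhds b 0) (hb.mono_left (pure_le_nhdsWithin (by simp))) (by simp)
  have hw : fderiv ℝ χ 0 (η' w) = w := by
    have h1 : HasDerivWithinAt (fun τ ↦ χ (b τ)) (fderiv ℝ χ 0 (η' w)) (Ici 0) 0 := by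
      have : HasFDerivAt χ (fderiv ℝ χ 0) (b 0) := by rw [hb0]; exact hχd.hasFDerivAt
      exact this.comp_hasDerivWithinAt 0 hb'
    have h2 : (fun τ ↦ χ (b τ)) =ᶠ[𝓝[≥] 0] fun τ : ℝ ↦ φ (x + τ • e) := hbφ.mono fun τ h ↦ h.2
    exact (uniqueDiffWithinAt_Ici 0).eq_deriv _ h1
      (hc.hasDerivWithinAt.congr_of_eventuallyEq h2 (h2.self_of_nhdsWithin (by simp)))
  -- the opposite curve in the interior parametrization has outward velocity
  have hl2 : HasDerivAt (fun τ : ℝ ↦ -τ • η' w) (-η' w) 0 := by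
    simpa using ((hasDerivAt_id (0 : ℝ)).neg.smul_const (η' w))
  have hc2 : HasDerivAt (fun τ : ℝ ↦ χ (-τ • η' w)) (-w) 0 := by
    have : HasFDerivAt χ (fderiv ℝ χ 0) (-(0 : ℝ) • η' w) := by simpa using hχd.hasFDerivAt
    have h1 := this.comp_hasDerivAt 0 hl2
    rw [map_neg, hw] at h1
    exact h1
  have hct2 : Filter.Tendsto (fun τ : ℝ ↦ χ (-τ • η' w)) (𝓝[≥] 0) (𝓝 (φ x)) := by
    have := hc2.continuousAt.tendsto
    simp only [neg_zero, zero_smul, hχ.map_zero] at this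
    exact this.mono_left nhdsWithin_le_nhds
  have hcm2 : ∀ᶠ τ in 𝓝[≥] (0 : ℝ), χ (-τ • η' w) ∈ φ '' (V ∩ halfSpace k) := by
    have h1 : ∀ᶠ τ in 𝓝 (0 : ℝ), -τ • η' w ∈ V' :=
      hl2.continuousAt.eventually (by simpa using hχ.isOpen.mem_nhds hχ.zero_mem)
    have h2 : ∀ᶠ τ in 𝓝 (0 : ℝ), χ (-τ • η' w) ∈ U :=
      hc2.continuousAt.eventually (by simpa [hχ.map_zero] using hU.mem_nhds hqU)
    filter_upwards [nhdsWithin_le_nhds h1, nhdsWithin_le_nhds h2] with τ h1 h2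
    rw [hUim]
    exact ⟨(hUim'.subset (mem_image_of_mem χ h1)).1, h2⟩
  obtain ⟨d, hd, hdφ⟩ := h.embedding.exists_tendsto_lift hxH hct2 hcm2
  have hd' : HasDerivWithinAt d (-e) (Ici 0) 0 := by
    have h1 : HasDerivWithinAt (fun τ : ℝ ↦ θ (χ (-τ • η' w))) (-e) (Ici 0) 0 := by
      have : HasFDerivAt θ θ' (χ (-(0 : ℝ) • η' w)) := by
        simpa [hχ.map_zero] using hθ.hasFDerivAt
      have h1 := (this.comp_hasDerivAt 0 hc2).hasDerivWithinAt (s := Ici 0)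
      rw [map_neg, hθ'] at h1
      exact h1
    have h2 : d =ᶠ[𝓝[≥] 0] fun τ : ℝ ↦ θ (χ (-τ • η' w)) := by
      filter_upwards [hd.eventually hθl, hdφ] with τ h1 h2
      rw [← h2.2, h1]
    exact h1.congr_of_eventuallyEq h2 (h2.self_of_nhdsWithin (by simp))
  have hd0 : d 0 = x := tendsto_nhds_unique_of_eventuallyEq (l := pure 0)
    (tendsto_pure_nhds d 0) (hd.mono_left (pure_le_nhdsWithin (by simp))) (by simp)
  have hd1 : HasDerivWithinAt (fun τ ↦ (d τ).1) (-1) (Ici 0) 0 := by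
    have h1 := (ContinuousLinearMap.fst ℝ ℝ (EuclideanSpace ℝ (Fin k))).hasFDerivAt
      (x := d 0) |>.comp_hasDerivWithinAt 0 hd'
    simpa [e, Function.comp_def] using h1
  have := hd1.nonneg_of_eventually_le (hdφ.mono fun τ hτ ↦ by
    rw [hd0, hx0]
    exact hτ.1.2)
  linarith

end BoundaryPoints

/-! ### Collars of p-submanifolds, with the radius as a coordinate. -/

section Collar

variable {n : ℕ} {N : Set (ℝ × EuclideanSpace ℝ (Fin n))}

/-- In a boundary parametrization of a p-submanifold, the radial coordinate vanishes on the boundary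
of the half-space. -/
theorem IsPSubmanifold.fst_eq_zero (hN : IsPSubmanifold N) {k : ℕ}
    {p : ℝ × EuclideanSpace ℝ (Fin n)}
    {φ : ℝ × EuclideanSpace ℝ (Fin k) → ℝ × EuclideanSpace ℝ (Fin n)}
    {V : Set (ℝ × EuclideanSpace ℝ (Fin k))} (h : IsBoundaryParam N p φ V)
    {x : ℝ × EuclideanSpace ℝ (Fin k)} (hx : x ∈ V) (hx0 : x.1 = 0) : (φ x).1 = 0 := by
  obtain ⟨U, -, hU⟩ := h.image
  have hxN : φ x ∈ N := (hU.subset (mem_image_of_mem φ ⟨hx, hx0.ge⟩)).1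
  -- A point of positive radius is an interior point of `N`, which a boundary point cannot be.
  by_contra hne
  exact h.not_isSmoothAt hx hx0 (hN.interior _ hxN ((hN.subset hxN).1.lt_of_ne (Ne.symm hne)))

/-- In a boundary parametrization of a p-submanifold, the differential of the radial coordinate is a
positive multiple of the first coordinate. -/
theorem IsPSubmanifold.exists_fst_fderiv_eq (hN : IsPSubmanifold N) {k : ℕ}
    {p : ℝ × EuclideanSpace ℝ (Fin n)} (hp0 : p.1 = 0)
    {φ : ℝ × EuclideanSpace ℝ (Fin k) → ℝ × EuclideanSpace ℝ (Fin n)}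
    {V : Set (ℝ × EuclideanSpace ℝ (Fin k))} (h : IsBoundaryParam N p φ V)
    (ht : LinearMap.range (fderiv ℝ φ 0).toLinearMap ⊔ tangentFrontFace p.2 = tangentBlowUp p.2) :
    ∃ α : ℝ, 0 < α ∧ ∀ y, (fderiv ℝ φ 0 y).1 = α * y.1 := by
  have hφ := (h.hasStrictFDerivAt h.zero_mem).hasFDerivAt
  have curve : ∀ v : ℝ × EuclideanSpace ℝ (Fin k),
      HasDerivAt (fun τ : ℝ ↦ (φ (τ • v)).1) (fderiv ℝ φ 0 v).1 0 := by
    intro v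
    have h1 : HasDerivAt (fun τ : ℝ ↦ τ • v) v 0 := by
      simpa using (hasDerivAt_id (0 : ℝ)).smul_const v
    have h2 : HasFDerivAt φ (fderiv ℝ φ 0) ((0 : ℝ) • v) := by simpa using hφ
    exact (ContinuousLinearMap.fst ℝ ℝ (EuclideanSpace ℝ (Fin n))).hasFDerivAt.comp_hasDerivAt 0
      (h2.comp_hasDerivAt 0 h1)
  have hV : ∀ v : ℝ × EuclideanSpace ℝ (Fin k), ∀ᶠ τ in 𝓝 (0 : ℝ), τ • v ∈ V := fun v ↦ by
    have h1 : Continuous fun τ : ℝ ↦ τ • v := by fun_prop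
    exact h1.continuousAt.eventually (by simpa using h.isOpen.mem_nhds h.zero_mem)
  have h0 : ∀ v : EuclideanSpace ℝ (Fin k), (fderiv ℝ φ 0 (0, v)).1 = 0 := by
    intro v
    refine (curve (0, v)).unique ((hasDerivAt_const (0 : ℝ) (0 : ℝ)).congr_of_eventuallyEq ?_)
    filter_upwards [hV (0, v)] with τ hτ
    exact hN.fst_eq_zero h hτ (by simp)
  have hlin : ∀ y, (fderiv ℝ φ 0 y).1 = (fderiv ℝ φ 0 (1, 0)).1 * y.1 := by
    rintro ⟨s, v⟩
    have : ((s, v) : ℝ × EuclideanSpace ℝ (Fin k)) = s • (1, 0) + (0, v) := by ext <;> simp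
    rw [this, map_add, map_smul, Prod.fst_add, h0]
    simp [mul_comm]
  refine ⟨_, lt_of_le_of_ne ?_ ?_, hlin⟩
  -- The multiple is non-negative because the radius is non-negative on `N` and zero at `p`.
  · refine (curve (1, 0)).hasDerivWithinAt.nonneg_of_eventually_le ?_
    filter_upwards [nhdsWithin_le_nhds (hV (1, 0)), self_mem_nhdsWithin] with τ hτ hτ0
    obtain ⟨U, -, hU⟩ := h.image
    have hm : φ (τ • (1, 0)) ∈ N := (hU.subset (mem_image_of_mem φ ⟨hτ, by simpa [halfSpace] using hτ0⟩)).1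
    simpa [h.map_zero, hp0] using (hN.subset hm).1
  -- It is non-zero by transversality: otherwise both summands would be tangent to the front face,
  -- leaving no radial direction.
  · intro hα
    have h1 : ((1, 0) : ℝ × EuclideanSpace ℝ (Fin n)) ∈ tangentBlowUp p.2 := by
      simp [tangentBlowUp, Submodule.mem_prod]
    rw [← ht, Submodule.mem_sup] at h1
    obtain ⟨_, ⟨y, rfl⟩, z, hz, hyz⟩ := h1
    have hz0 : z.1 = 0 := by simpa using (Submodule.mem_prod.1 hz).1
    have := congrArg Prod.fst hyz
    rw [Prod.fst_add, hz0, ContinuousLinearMap.coe_coe, hlin y, ← hα] at this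
    simp at this

/-- Near a boundary point, a p-submanifold has a bi-Lipschitz parametrization by a half ball which
preserves the radial coordinate. -/
theorem IsPSubmanifold.exists_collar (hN : IsPSubmanifold N) {p : ℝ × EuclideanSpace ℝ (Fin n)}
    (hp : p ∈ N) (hp0 : p.1 = 0) {ρ : ℝ} (hρ : 0 < ρ) :
    ∃ (k : ℕ) (G : ℝ × EuclideanSpace ℝ (Fin k) → ℝ × EuclideanSpace ℝ (Fin n)) (K : ℝ≥0),
      ∃ ε > 0, ε ≤ ρ ∧ (∀ y ∈ Metric.ball 0 ε, 0 ≤ y.1 → G y ∈ N ∧ (G y).1 = y.1) ∧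
      LipschitzOnWith K G (Metric.ball 0 ε) ∧
      (∀ y ∈ Metric.ball 0 ε, ∀ z ∈ Metric.ball 0 ε, dist y z ≤ K * dist (G y) (G z)) ∧
      ∀ᶠ q in 𝓝[N] p, ∃ y ∈ Metric.ball 0 ε, 0 ≤ y.1 ∧ G y = q := by
  obtain ⟨k, φ, V, h, ht⟩ := hN.boundary p hp hp0
  obtain ⟨α, hα, hlin⟩ := hN.exists_fst_fderiv_eq hp0 h ht
  have hφ := h.hasStrictFDerivAt h.zero_mem
  let e : (ℝ × EuclideanSpace ℝ (Fin k)) ≃L[ℝ] (ℝ × EuclideanSpace ℝ (Fin k)) :=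
    (ContinuousLinearEquiv.unitsEquivAut ℝ (Units.mk0 α hα.ne')).prodCongr
      (ContinuousLinearEquiv.refl ℝ _)
  -- The first coordinate is replaced by the radius. The derivative at `0` is diagonal with entries
  -- `α` and the identity, so `Φ` is locally invertible, and `φ ∘ Φ⁻¹` preserves the radius.
  let Φ : ℝ × EuclideanSpace ℝ (Fin k) → ℝ × EuclideanSpace ℝ (Fin k) := fun y ↦ ((φ y).1, y.2)
  have hΦ : HasStrictFDerivAt Φ (e : _ →L[ℝ] _) 0 := by
    have h1 : HasStrictFDerivAt Φ (((ContinuousLinearMap.fst ℝ ℝ (EuclideanSpace ℝ (Fin n))).comp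
        (fderiv ℝ φ 0)).prod (ContinuousLinearMap.snd ℝ ℝ (EuclideanSpace ℝ (Fin k)))) 0 :=
      hφ.fst.prodMk hasStrictFDerivAt_snd
    convert h1 using 1
    ext y <;> simp [e, hlin, mul_comm]
  have hΦ0 : Φ 0 = 0 := by simp [Φ, h.map_zero, hp0]
  let Ψ := hΦ.localInverse Φ e 0
  have hΨ : HasStrictFDerivAt Ψ (e.symm : _ →L[ℝ] _) 0 := by
    simpa [hΦ0] using hΦ.to_localInverse
  have hΨ0 : Ψ 0 = 0 := by simpa [hΦ0] using hΦ.localInverse_apply_image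
  have hright : ∀ᶠ y in 𝓝 0, Φ (Ψ y) = y := by simpa [hΦ0] using hΦ.eventually_right_inverse
  have hleft : ∀ᶠ y in 𝓝 0, Ψ (Φ y) = y := hΦ.eventually_left_inverse
  have hG : HasStrictFDerivAt (φ ∘ Ψ) ((fderiv ℝ φ 0).comp (e.symm : _ →L[ℝ] _)) 0 := by
    have h1 : HasStrictFDerivAt φ (fderiv ℝ φ 0) (Ψ 0) := by rwa [hΨ0]
    exact h1.comp 0 hΨ
  obtain ⟨K₁, s₁, hs₁, hK₁⟩ := hG.exists_lipschitzOnWith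
  obtain ⟨K₂, s₂, hs₂, hK₂⟩ := hG.eventually_dist_le
    ((h.immersion 0 ⟨h.zero_mem, zero_mem_halfSpace k⟩).comp e.symm.injective)
  -- This makes the inverse of `Φ` preserve the half-space. Compare `y` with the boundary point `(0,
  -- y.2)`, of radius zero: the radius changes by `α * y.1` up to an error of half that size.
  have hsign : ∀ᶠ y in 𝓝 (0 : ℝ × EuclideanSpace ℝ (Fin k)), y.1 < 0 → (φ y).1 < 0 := by
    have h1 := hφ.fst.isLittleO.def (half_pos hα)
    have h2 : Filter.Tendsto (fun y : ℝ × EuclideanSpace ℝ (Fin k) ↦ (y, ((0 : ℝ), y.2))) (𝓝 0)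
        (𝓝 (0, 0)) := by
      have : Continuous fun y : ℝ × EuclideanSpace ℝ (Fin k) ↦ (y, ((0 : ℝ), y.2)) := by fun_prop
      exact this.tendsto 0
    have h3 : ∀ᶠ y in 𝓝 (0 : ℝ × EuclideanSpace ℝ (Fin k)), ((0 : ℝ), y.2) ∈ V := by
      have : Continuous fun y : ℝ × EuclideanSpace ℝ (Fin k) ↦ ((0 : ℝ), y.2) := by fun_prop
      exact (this.tendsto 0).eventually (h.isOpen.mem_nhds h.zero_mem)
    filter_upwards [h2.eventually h1, h3] with y hy hyV hy0
    have h4 : y - ((0 : ℝ), y.2) = (y.1, 0) := by ext <;> simp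
    rw [hN.fst_eq_zero h hyV rfl, h4] at hy
    have h5 : (((ContinuousLinearMap.fst ℝ ℝ (EuclideanSpace ℝ (Fin n))).comp
        (fderiv ℝ φ 0)) (y.1, 0)) = α * y.1 := hlin _
    have h6 : ‖((y.1, 0) : ℝ × EuclideanSpace ℝ (Fin k))‖ = -y.1 := by
      simp [Prod.norm_def, abs_of_neg hy0]
      exact hy0.le
    rw [h5, h6, sub_zero, Real.norm_eq_abs] at hy
    have := (abs_le.1 hy).2
    nlinarith
  have hΨc : Filter.Tendsto Ψ (𝓝 0) (𝓝 0) := by simpa [hΨ0] using hΨ.continuousAt.tendsto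
  obtain ⟨ε₀, hε₀, hball₀⟩ := Metric.mem_nhds_iff.1 (Filter.inter_mem (Filter.inter_mem hs₁ hs₂)
    (hright.and ((hΨc.eventually hsign).and (hΨc.eventually (h.isOpen.mem_nhds h.zero_mem)))))
  set ε := min ε₀ ρ
  have hε : 0 < ε := lt_min hε₀ hρ
  have hball := (Metric.ball_subset_ball (min_le_left ε₀ ρ)).trans hball₀
  obtain ⟨U, hU, hUim⟩ := h.image
  refine ⟨k, φ ∘ Ψ, max K₁ K₂, ε, hε, min_le_right _ _, fun y hy hy0 ↦ ?_, ?_, fun y hy z hz ↦ ?_, ?_⟩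
  · obtain ⟨-, hr, hs, hv⟩ := hball hy
    have h1 : (φ (Ψ y)).1 = y.1 := congrArg Prod.fst hr
    refine ⟨(hUim.subset (mem_image_of_mem φ ⟨hv, ?_⟩)).1, h1⟩
    by_contra hneg
    have := hs (not_le.1 hneg)
    linarith
  · exact (hK₁.mono fun y hy ↦ (hball hy).1.1).weaken (le_max_left _ _)
  · refine (hK₂ y (hball hy).1.2 z (hball hz).1.2).trans ?_
    gcongr
    exact le_max_right _ _
  · have h1 : Filter.Tendsto id (𝓝[N] p) (𝓝 (φ 0)) := by
      rw [h.map_zero]; exact nhdsWithin_le_nhds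
    have h2 : ∀ᶠ q in 𝓝[N] p, id q ∈ φ '' (V ∩ halfSpace k) := by
      have hpU : p ∈ U := by
        have := (hUim.subset (mem_image_of_mem φ ⟨h.zero_mem, zero_mem_halfSpace k⟩)).2
        rwa [h.map_zero] at this
      filter_upwards [self_mem_nhdsWithin, nhdsWithin_le_nhds (hU.mem_nhds hpU)] with q h1 h2
      rw [hUim]
      exact ⟨h1, h2⟩
    obtain ⟨b, hb, hbφ⟩ := h.embedding.exists_tendsto_lift ⟨h.zero_mem, zero_mem_halfSpace k⟩ h1 h2
    have hΦc : Filter.Tendsto Φ (𝓝 0) (𝓝 0) := by simpa [hΦ0] using hΦ.continuousAt.tendsto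
    filter_upwards [hbφ, hb.eventually hleft,
      (hΦc.comp hb).eventually (Metric.ball_mem_nhds 0 hε), self_mem_nhdsWithin]
      with q h1 h2 h3 h4
    refine ⟨Φ (b q), h3, ?_, ?_⟩
    · have : (Φ (b q)).1 = q.1 := congrArg Prod.fst h1.2
      rw [this]
      exact (hN.subset h4).1
    · rw [Function.comp_apply, h2]
      exact h1.2

end Collar

/-! ### Metric estimates for the blowing-down map. -/

section BlowDown

variable {n : ℕ} (a : EuclideanSpace ℝ (Fin n)) {q q' : ℝ × EuclideanSpace ℝ (Fin n)}

theorem dist_blowDown_center (hq : q ∈ blowUp n) : dist (blowDown a q) a = q.1 := by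
  simp [blowDown, norm_smul, hq.2, abs_of_nonneg hq.1]

/-- The difference splits into a radial move in the direction `q'.2` and a rotation at radius `q.1`.
-/
theorem dist_blowDown_le (hq : q ∈ blowUp n) (hq' : q' ∈ blowUp n) :
    dist (blowDown a q) (blowDown a q') ≤ |q.1 - q'.1| + q.1 * dist q.2 q'.2 := by
  have h : blowDown a q - blowDown a q' = (q.1 - q'.1) • q'.2 + q.1 • (q.2 - q'.2) := by
    simp only [blowDown]; module
  rw [dist_eq_norm, h, dist_eq_norm]
  refine (norm_add_le _ _).trans_eq ?_
  simp [norm_smul, hq'.2, abs_of_nonneg hq.1]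

theorem abs_fst_sub_le (hq : q ∈ blowUp n) (hq' : q' ∈ blowUp n) :
    |q.1 - q'.1| ≤ dist (blowDown a q) (blowDown a q') := by
  rw [← dist_blowDown_center a hq, ← dist_blowDown_center a hq']
  exact abs_dist_sub_le _ _ _

/-- The rotation is the whole displacement minus its radial part, and each has norm at most the
outer distance; hence the factor `2`. -/
theorem fst_mul_dist_snd_le (hq : q ∈ blowUp n) (hq' : q' ∈ blowUp n) :
    q.1 * dist q.2 q'.2 ≤ 2 * dist (blowDown a q) (blowDown a q') := by
  have h : q.1 • (q.2 - q'.2) = (blowDown a q - blowDown a q') + (q'.1 - q.1) • q'.2 := by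
    simp only [blowDown]; module
  calc q.1 * dist q.2 q'.2 = ‖q.1 • (q.2 - q'.2)‖ := by
        rw [norm_smul, dist_eq_norm, Real.norm_of_nonneg hq.1]
    _ ≤ ‖blowDown a q - blowDown a q'‖ + ‖(q'.1 - q.1) • q'.2‖ := by
        rw [h]; exact norm_add_le _ _
    _ = dist (blowDown a q) (blowDown a q') + |q.1 - q'.1| := by
        rw [norm_smul, hq'.2, mul_one, ← dist_eq_norm, Real.norm_eq_abs, abs_sub_comm]
    _ ≤ _ := by linarith [abs_fst_sub_le a hq hq']

theorem continuous_blowDown : Continuous (blowDown a) := by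
  unfold blowDown
  fun_prop

/-- Points of `S` near `a` lift to the strict transform. -/
theorem exists_mem_strictTransform {S : Set (EuclideanSpace ℝ (Fin n))}
    {x : EuclideanSpace ℝ (Fin n)} (hx : x ∈ S) (hxa : x ≠ a) :
    ∃ q ∈ strictTransform S a, q.1 = dist x a ∧ blowDown a q = x := by
  have h0 : ‖x - a‖ ≠ 0 := norm_ne_zero_iff.2 (sub_ne_zero.2 hxa)
  have h1 : blowDown a (dist x a, ‖x - a‖⁻¹ • (x - a)) = x := by
    simp [blowDown, dist_eq_norm, smul_smul, h0]
  refine ⟨(dist x a, ‖x - a‖⁻¹ • (x - a)), subset_closure ⟨⟨dist_nonneg, ?_⟩, ?_⟩, rfl, h1⟩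
  · simp [norm_smul, h0]
  · rw [mem_preimage, h1]
    exact ⟨hx, hxa⟩

/-- In a radius preserving bi-Lipschitz parametrization, the inner distance of the image in `ℝⁿ` is
controlled by the outer one: segments map to short paths. -/
theorem innerEDist_blowDown_le {F : Type*} [NormedAddCommGroup F] [NormedSpace ℝ F]
    {S : Set (EuclideanSpace ℝ (Fin n))} {G : ℝ × F → ℝ × EuclideanSpace ℝ (Fin n)} {K : ℝ≥0}
    {ε : ℝ}
    (hG : ∀ y ∈ Metric.ball 0 ε, 0 ≤ y.1 → G y ∈ blowUp n ∧ blowDown a (G y) ∈ S ∧ (G y).1 = y.1)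
    (hlip : LipschitzOnWith K G (Metric.ball 0 ε))
    (hanti : ∀ y ∈ Metric.ball 0 ε, ∀ z ∈ Metric.ball 0 ε, dist y z ≤ K * dist (G y) (G z)) :
    ∃ C : ℝ≥0, ∀ y ∈ Metric.ball 0 ε, ∀ z ∈ Metric.ball 0 ε, 0 ≤ y.1 → 0 ≤ z.1 →
      innerEDist S (blowDown a (G y)) (blowDown a (G z)) ≤
        C * edist (blowDown a (G y)) (blowDown a (G z)) := by
  refine ⟨Real.toNNReal (1 + K * (K * (ε + 2) + 2 * ε)), fun y hy z hz hy0 hz0 ↦ ?_⟩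
  have hε : 0 < ε := Metric.pos_of_mem_ball hy
  obtain ⟨hyb, -, hy1⟩ := hG y hy hy0
  obtain ⟨hzb, -, hz1⟩ := hG z hz hz0
  set D := dist (blowDown a (G y)) (blowDown a (G z))
  have hyε : y.1 < ε := by
    have := (norm_fst_le y).trans_lt (mem_ball_zero_iff.1 hy)
    exact (le_abs_self _).trans_lt this
  have hyz : dist y z ≤ 2 * ε := by
    have := dist_triangle_right y z 0
    linarith [Metric.mem_ball.1 hy, Metric.mem_ball.1 hz]
  have hD1 : |y.1 - z.1| ≤ D := by
    rw [← hy1, ← hz1]; exact abs_fst_sub_le a hyb hzb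
  -- Only after weighting by the radius is the parameter distance controlled by `D`: near the
  -- centre, points in different directions are close.
  have hD2 : y.1 * dist y z ≤ K * (ε + 2) * D := by
    have h1 : dist (G y) (G z) ≤ D + dist (G y).2 (G z).2 := by
      rw [Prod.dist_eq]
      refine max_le ?_ (by linarith [dist_nonneg (x := blowDown a (G y)) (y := blowDown a (G z))])
      rw [Real.dist_eq, hy1, hz1]
      linarith [dist_nonneg (x := (G y).2) (y := (G z).2)]
    have h2 : y.1 * dist (G y).2 (G z).2 ≤ 2 * D := by
      rw [← hy1]; exact fst_mul_dist_snd_le a hyb hzb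
    have hD0 : 0 ≤ D := dist_nonneg
    calc y.1 * dist y z ≤ y.1 * (K * (D + dist (G y).2 (G z).2)) := by
          gcongr
          exact (hanti y hy z hz).trans (by gcongr)
      _ = K * (y.1 * D + y.1 * dist (G y).2 (G z).2) := by ring
      _ ≤ K * (ε * D + 2 * D) := by gcongr
      _ = _ := by ring
  have hD3 : max y.1 z.1 * dist y z ≤ (K * (ε + 2) + 2 * ε) * D := by
    have h1 : max y.1 z.1 ≤ y.1 + |y.1 - z.1| := max_le (by linarith [abs_nonneg (y.1 - z.1)])
      (by linarith [neg_abs_le (y.1 - z.1)])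
    calc max y.1 z.1 * dist y z ≤ (y.1 + |y.1 - z.1|) * dist y z := by gcongr
      _ = y.1 * dist y z + |y.1 - z.1| * dist y z := by ring
      _ ≤ K * (ε + 2) * D + D * (2 * ε) := by gcongr
      _ = _ := by ring
  -- Lipschitz constant of the blown-down segment: its radial speed, plus the largest radius times
  -- its angular speed.
  set c := |y.1 - z.1| + max y.1 z.1 * (K * dist y z)
  have hc0 : 0 ≤ c := by positivity
  have hc : c ≤ (1 + K * (K * (ε + 2) + 2 * ε)) * D := by
    have : max y.1 z.1 * (K * dist y z) = K * (max y.1 z.1 * dist y z) := by ring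
    have h2 := mul_le_mul_of_nonneg_left hD3 K.2
    simp only [c, this]
    calc _ ≤ D + K * ((K * (ε + 2) + 2 * ε) * D) := add_le_add hD1 h2
      _ = _ := by ring
  let m : ℝ → ℝ × F := AffineMap.lineMap y z
  have hm : ∀ t ∈ Icc (0 : ℝ) 1, m t ∈ Metric.ball 0 ε ∧ 0 ≤ (m t).1 ∧ (m t).1 ≤ max y.1 z.1 := by
    intro t ht
    have h1 : (m t).1 = (1 - t) * y.1 + t * z.1 := by
      simp [m, AffineMap.lineMap_apply]; ring
    refine ⟨(convex_ball (0 : ℝ × F) ε).lineMap_mem hy hz ht, ?_, ?_⟩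
    · rw [h1]
      have := ht.1; have := ht.2
      have := mul_nonneg (sub_nonneg.2 ht.2) hy0
      have := mul_nonneg ht.1 hz0
      linarith
    · rw [h1]
      have := mul_le_mul_of_nonneg_left (le_max_left y.1 z.1) (sub_nonneg.2 ht.2)
      have := mul_le_mul_of_nonneg_left (le_max_right y.1 z.1) ht.1
      linarith
  have hpath : innerEDist S (blowDown a (G (m 0))) (blowDown a (G (m 1))) ≤ (Real.toNNReal c : ℝ≥0) := by
    refine innerEDist_le_of_lipschitzOnWith (γ := fun t ↦ blowDown a (G (m t))) ?_ fun t ht ↦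
      (hG _ (hm t ht).1 (hm t ht).2.1).2.1
    refine LipschitzOnWith.of_dist_le_mul fun s hs t ht ↦ ?_
    rw [Real.coe_toNNReal c hc0]
    obtain ⟨hsb, hs0, hsm⟩ := hm s hs
    obtain ⟨htb, ht0, -⟩ := hm t ht
    obtain ⟨g1, -, g2⟩ := hG _ hsb hs0
    obtain ⟨g3, -, g4⟩ := hG _ htb ht0
    have d1 : dist (m s) (m t) = dist s t * dist y z := dist_lineMap_lineMap y z s t
    have d2 : |(m s).1 - (m t).1| = dist s t * |y.1 - z.1| := by
      rw [Real.dist_eq, ← abs_mul, ← abs_neg]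
      congr 1
      simp [m, AffineMap.lineMap_apply]; ring
    have d3 : dist (G (m s)).2 (G (m t)).2 ≤ K * (dist s t * dist y z) := by
      rw [← d1]
      exact (le_max_right _ _).trans (hlip.dist_le_mul _ hsb _ htb)
    refine (dist_blowDown_le a g1 g3).trans ?_
    rw [g2, g4, d2]
    calc dist s t * |y.1 - z.1| + (m s).1 * dist (G (m s)).2 (G (m t)).2
        ≤ dist s t * |y.1 - z.1| + max y.1 z.1 * (K * (dist s t * dist y z)) := by gcongr
      _ = c * dist s t := by simp only [c]; ring
  have hm0 : m 0 = y := by simp [m]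
  have hm1 : m 1 = z := by simp [m]
  rw [hm0, hm1] at hpath
  refine hpath.trans ?_
  rw [edist_dist, ← ENNReal.ofReal_coe_nnreal, ← ENNReal.ofReal_coe_nnreal,
    ← ENNReal.ofReal_mul NNReal.zero_le_coe, Real.coe_toNNReal c hc0]
  refine ENNReal.ofReal_le_ofReal (hc.trans ?_)
  gcongr
  exact Real.le_coe_toNNReal _

end BlowDown

/-! ### The local estimate at a conic point. -/

section ConicPoint

variable {n : ℕ} {a : EuclideanSpace ℝ (Fin n)} {N : Set (ℝ × EuclideanSpace ℝ (Fin n))}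
  {S : Set (EuclideanSpace ℝ (Fin n))} {ρ : ℝ}

/-- Two points of a p-submanifold in nearby directions blow down to points whose inner distance is
controlled. -/
theorem IsPSubmanifold.innerEDist_le_of_near (hN : IsPSubmanifold N) (hρ : 0 < ρ)
    (hS : ∀ q ∈ N, q.1 < ρ → blowDown a q ∈ S) {p : ℝ × EuclideanSpace ℝ (Fin n)} (hp : p ∈ N)
    (hp0 : p.1 = 0) :
    ∃ C : ℝ≥0, (∀ᶠ q in 𝓝 (p, p), q.1 ∈ N → q.2 ∈ N →
      innerEDist S (blowDown a q.1) (blowDown a q.2) ≤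
        C * edist (blowDown a q.1) (blowDown a q.2)) ∧
      ∀ᶠ q in 𝓝 p, q ∈ N → innerEDist S (blowDown a q) a ≤ C * edist (blowDown a q) a := by
  obtain ⟨k, G, K, ε, hε, hερ, hG, hlip, hanti, hcov⟩ := hN.exists_collar hp hp0 hρ
  obtain ⟨C, hC⟩ := innerEDist_blowDown_le a (S := S) (fun y hy hy0 ↦ by
    obtain ⟨h1, h2⟩ := hG y hy hy0
    refine ⟨hN.subset h1, hS _ h1 ?_, h2⟩
    rw [h2]
    have := (norm_fst_le y).trans_lt (mem_ball_zero_iff.1 hy)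
    exact ((le_abs_self _).trans_lt this).trans_le hερ) hlip hanti
  have hcov' := eventually_nhdsWithin_iff.1 hcov
  refine ⟨C, ?_, ?_⟩
  · rw [nhds_prod_eq]
    filter_upwards [hcov'.prod_mk hcov'] with q hq h1 h2
    obtain ⟨y, hy, hy0, hyq⟩ := hq.1 h1
    obtain ⟨z, hz, hz0, hzq⟩ := hq.2 h2
    rw [← hyq, ← hzq]
    exact hC y hy z hz hy0 hz0
  · filter_upwards [hcov'] with q hq h1
    obtain ⟨y, hy, hy0, rfl⟩ := hq h1
    -- The point with the same second coordinate on the boundary has radius `0`, so it blows down to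
    -- `a`.
    have hz : ((0 : ℝ), y.2) ∈ Metric.ball (0 : ℝ × EuclideanSpace ℝ (Fin k)) ε := by
      rw [mem_ball_zero_iff] at hy ⊢
      refine lt_of_le_of_lt ?_ hy
      simp [Prod.norm_def]
    have hz' : blowDown a (G ((0 : ℝ), y.2)) = a := by
      simp [blowDown, (hG _ hz le_rfl).2]
    simpa [hz'] using hC y hy _ hz hy0 le_rfl

/-- For distinct boundary points the directions stay at distance more than some `η > 0`, so both
radii are at most `2 / η` times the outer distance, and the detour through `a` is short enough.
Equal boundary points are the case of nearby directions. -/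
theorem IsPSubmanifold.innerEDist_le_of_boundary (hN : IsPSubmanifold N) (hρ : 0 < ρ)
    (hS : ∀ q ∈ N, q.1 < ρ → blowDown a q ∈ S) {p p' : ℝ × EuclideanSpace ℝ (Fin n)} (hp : p ∈ N)
    (hp0 : p.1 = 0) (hp' : p' ∈ N) (hp0' : p'.1 = 0) :
    ∃ C : ℝ≥0, ∀ᶠ q in 𝓝 (p, p'), q.1 ∈ N → q.2 ∈ N →
      innerEDist S (blowDown a q.1) (blowDown a q.2) ≤
        C * edist (blowDown a q.1) (blowDown a q.2) := by
  by_cases hpp : p = p'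
  · subst hpp
    obtain ⟨C, hC, -⟩ := hN.innerEDist_le_of_near hρ hS hp hp0
    exact ⟨C, hC⟩
  have hd : 0 < dist p.2 p'.2 := dist_pos.2 fun h ↦ hpp (Prod.ext (hp0.trans hp0'.symm) h)
  obtain ⟨C, -, hC⟩ := hN.innerEDist_le_of_near hρ hS hp hp0
  obtain ⟨C', -, hC'⟩ := hN.innerEDist_le_of_near hρ hS hp' hp0'
  set η := dist p.2 p'.2 / 2
  have hη : 0 < η := half_pos hd
  have h1 : ∀ᶠ q : (ℝ × EuclideanSpace ℝ (Fin n)) × (ℝ × EuclideanSpace ℝ (Fin n)) in 𝓝 (p, p'),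
      η < dist q.1.2 q.2.2 := by
    have : Continuous fun q : (ℝ × EuclideanSpace ℝ (Fin n)) × (ℝ × EuclideanSpace ℝ (Fin n)) ↦
      dist q.1.2 q.2.2 := by fun_prop
    exact (this.tendsto (p, p')).eventually (lt_mem_nhds (half_lt_self hd))
  refine ⟨(C + C') * Real.toNNReal (2 / η), ?_⟩
  filter_upwards [h1, (continuous_fst.tendsto (p, p')).eventually hC,
    (continuous_snd.tendsto (p, p')).eventually hC'] with q hq h2 h3 hq1 hq2
  have hb1 := hN.subset hq1
  have hb2 := hN.subset hq2
  set D := dist (blowDown a q.1) (blowDown a q.2)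
  have key : ∀ {t d : ℝ}, 0 ≤ t → η < d → t * d ≤ 2 * D →
      ENNReal.ofReal t ≤ Real.toNNReal (2 / η) * ENNReal.ofReal D := by
    intro t d ht hd h
    rw [← ENNReal.ofReal_coe_nnreal, Real.coe_toNNReal _ (by positivity),
      ← ENNReal.ofReal_mul (by positivity)]
    refine ENNReal.ofReal_le_ofReal ?_
    rw [div_mul_eq_mul_div, le_div_iff₀ hη]
    nlinarith
  have e1 : edist (blowDown a q.1) a ≤ Real.toNNReal (2 / η) * ENNReal.ofReal D := by
    rw [edist_dist, dist_blowDown_center a hb1]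
    exact key hb1.1 hq (fst_mul_dist_snd_le a hb1 hb2)
  have e2 : edist (blowDown a q.2) a ≤ Real.toNNReal (2 / η) * ENNReal.ofReal D := by
    rw [edist_dist, dist_blowDown_center a hb2]
    refine key hb2.1 (by rwa [dist_comm] at hq) ?_
    simpa only [D, dist_comm (blowDown a q.1)] using fst_mul_dist_snd_le a hb2 hb1
  calc innerEDist S (blowDown a q.1) (blowDown a q.2)
      ≤ innerEDist S (blowDown a q.1) a + innerEDist S a (blowDown a q.2) :=
        innerEDist_triangle _ _ _ _
    _ ≤ C * edist (blowDown a q.1) a + C' * edist (blowDown a q.2) a := by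
        rw [innerEDist_comm S a]
        exact add_le_add (h2 hq1) (h3 hq2)
    _ ≤ C * (Real.toNNReal (2 / η) * ENNReal.ofReal D) +
        C' * (Real.toNNReal (2 / η) * ENNReal.ofReal D) := by gcongr
    _ = _ := by rw [edist_dist]; push_cast; ring

/-- A set is locally Lipschitz normally embedded at a conic point. -/
theorem IsConicPoint.exists_innerEDist_le {X : Set (EuclideanSpace ℝ (Fin n))}
    (h : IsConicPoint X a) {s : Set (EuclideanSpace ℝ (Fin n))} (hs : s ∈ 𝓝 a) :
    ∃ C : ℝ≥0, ∀ᶠ q in 𝓝 (a, a), q.1 ∈ X → q.2 ∈ X →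
      innerEDist (X ∩ s) q.1 q.2 ≤ C * edist q.1 q.2 := by
  obtain ⟨haX, ⟨Z, U, hZ, hU, haU, hXZ⟩, r, hr, hN⟩ := h
  set T := strictTransform (X ∩ Metric.ball a r) a
  set N := T ∩ {q | q.1 < r}
  obtain ⟨ρ, hρ, hρU⟩ := Metric.mem_nhds_iff.1 (Filter.inter_mem hs (hU.mem_nhds haU))
  have hS : ∀ q ∈ N, q.1 < ρ → blowDown a q ∈ X ∩ s := by
    intro q hq hqρ
    have h1 : blowDown a q ∈ Metric.ball a ρ := by
      rwa [Metric.mem_ball, dist_blowDown_center a (hN.subset hq)]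
    refine ⟨?_, (hρU h1).1⟩
    -- The strict transform lies over the closure of `X`, which near `a` adds nothing since `X`
    -- agrees there with a closed set.
    have h2 : blowDown a q ∈ closure X :=
      map_mem_closure (continuous_blowDown a) hq.1 fun x hx ↦ hx.2.1.1
    have h3 : blowDown a q ∈ closure (Metric.ball a ρ ∩ X) :=
      Metric.isOpen_ball.inter_closure ⟨h1, h2⟩
    have h4 : blowDown a q ∈ Z := by
      refine hZ.closure_subset_iff.2 (fun x hx ↦ ?_) h3
      exact (hXZ.subset ⟨hx.2, (hρU hx.1).2⟩).1
    exact (hXZ.superset ⟨h4, (hρU h1).2⟩).1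
  have hcomp : ∀ c < r, IsCompact (T ∩ {q | q.1 ≤ c}) := by
    intro c hc
    refine Metric.isCompact_of_isClosed_isBounded
      (isClosed_closure.inter (isClosed_le continuous_fst continuous_const)) ?_
    refine (Metric.isBounded_closedBall (x := 0) (r := max c 1)).subset fun q hq ↦ ?_
    have hqb := hN.subset ⟨hq.1, lt_of_le_of_lt hq.2 hc⟩
    rw [mem_closedBall_zero_iff, Prod.norm_def, hqb.2, Real.norm_of_nonneg hqb.1]
    exact max_le_max_right _ hq.2
  -- The link of `X` at `a`; its compactness makes the constants uniform.
  set K₀ := T ∩ {q | q.1 ≤ 0}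
  have hK₀ : IsCompact K₀ := hcomp 0 hr
  have hK₀N : ∀ q ∈ K₀, q ∈ N ∧ q.1 = 0 := fun q hq ↦ by
    have h1 : q ∈ N := ⟨hq.1, lt_of_le_of_lt hq.2 hr⟩
    exact ⟨h1, le_antisymm hq.2 (hN.subset h1).1⟩
  obtain ⟨C, hC⟩ := (hK₀.prod hK₀).exists_forall_eventually_nhdsSet
    (P := fun C q ↦ q.1 ∈ N → q.2 ∈ N → innerEDist (X ∩ s) (blowDown a q.1) (blowDown a q.2) ≤
        C * edist (blowDown a q.1) (blowDown a q.2))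
    (fun q c c' hcc h h1 h2 ↦ (h h1 h2).trans (by gcongr))
    (fun q hq ↦ hN.innerEDist_le_of_boundary hρ hS (hK₀N _ hq.1).1 (hK₀N _ hq.1).2
      (hK₀N _ hq.2).1 (hK₀N _ hq.2).2)
  obtain ⟨C', hC'⟩ := hK₀.exists_forall_eventually_nhdsSet
    (P := fun C q ↦ q ∈ N → innerEDist (X ∩ s) (blowDown a q) a ≤ C * edist (blowDown a q) a)
    (fun q c c' hcc h h1 ↦ (h h1).trans (by gcongr))
    (fun q hq ↦ by
      obtain ⟨C, -, hC⟩ := hN.innerEDist_le_of_near hρ hS (hK₀N _ hq).1 (hK₀N _ hq).2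
      exact ⟨C, hC⟩)
  rw [hK₀.nhdsSet_prod_eq hK₀] at hC
  obtain ⟨t, ht, hCt⟩ := Filter.mem_prod_self_iff.1 hC
  obtain ⟨O, hO, hKO, hOt⟩ := mem_nhdsSet_iff_exists.1 (Filter.inter_mem ht hC')
  -- Outside the neighbourhood `O` of the link, the radius has a positive minimum on the compact
  -- truncated strict transform; so all points of small radius lie in `O`.
  obtain ⟨δ, hδ, hδr, hδO⟩ : ∃ δ > 0, δ < r ∧ ∀ q ∈ T, q.1 < δ → q ∈ O := by
    have hdiff : IsCompact ((T ∩ {q | q.1 ≤ r / 2}) \ O) :=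
      (hcomp (r / 2) (half_lt_self hr)).inter_right hO.isClosed_compl
    rcases ((T ∩ {q | q.1 ≤ r / 2}) \ O).eq_empty_or_nonempty with he | hne
    · refine ⟨r / 2, half_pos hr, half_lt_self hr, fun q hq hq' ↦ ?_⟩
      by_contra hqO
      exact he.subset ⟨⟨hq, hq'.le⟩, hqO⟩
    · obtain ⟨q₀, hq₀, hmin⟩ := hdiff.exists_isMinOn hne continuous_fst.continuousOn
      have hpos : 0 < q₀.1 := by
        by_contra hneg
        exact hq₀.2 (hKO ⟨hq₀.1.1, not_lt.1 hneg⟩)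
      refine ⟨min q₀.1 (r / 2), lt_min hpos (half_pos hr), (min_le_right _ _).trans_lt
        (half_lt_self hr), fun q hq hq' ↦ ?_⟩
      by_contra hqO
      have := isMinOn_iff.1 hmin q ⟨⟨hq, (hq'.trans_le (min_le_right _ _)).le⟩, hqO⟩
      exact absurd (hq'.trans_le (min_le_left _ _)) this.not_gt
  have lift : ∀ x ∈ X, x ∈ Metric.ball a δ → x ≠ a → ∃ q ∈ N, q ∈ O ∧ blowDown a q = x := by
    intro x hx hxδ hxa
    obtain ⟨q, hqT, hq1, hqx⟩ := exists_mem_strictTransform a (S := X ∩ Metric.ball a r)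
      ⟨hx, Metric.ball_subset_ball hδr.le hxδ⟩ hxa
    have hqδ : q.1 < δ := hq1.trans_lt hxδ
    exact ⟨q, ⟨hqT, hqδ.trans hδr⟩, hδO q hqT hqδ, hqx⟩
  have center : ∀ x ∈ X, x ∈ Metric.ball a δ → x ≠ a →
      innerEDist (X ∩ s) x a ≤ C' * edist x a := by
    intro x hx hxδ hxa
    obtain ⟨q, hqN, hqO, rfl⟩ := lift x hx hxδ hxa
    exact (hOt hqO).2 hqN
  refine ⟨max C C', ?_⟩
  rw [nhds_prod_eq]
  have hb := Metric.ball_mem_nhds a hδ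
  filter_upwards [Filter.prod_mem_prod hb hb] with ⟨x, y⟩ ⟨hxδ, hyδ⟩ hx hy
  dsimp only at hxδ hyδ hx hy ⊢
  by_cases hxa : x = a
  -- The centre is treated apart because the lift is only available for points other than `a`.
  · by_cases hya : y = a
    · rw [hxa, hya, innerEDist_self (S := X ∩ s) ⟨haX, mem_of_mem_nhds hs⟩]
      exact zero_le
    · rw [hxa, innerEDist_comm, edist_comm]
      exact (center y hy hyδ hya).trans (by gcongr; exact le_max_right _ _)
  · by_cases hya : y = a
    · rw [hya]
      exact (center x hx hxδ hxa).trans (by gcongr; exact le_max_right _ _)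
    · obtain ⟨q, hqN, hqO, rfl⟩ := lift x hx hxδ hxa
      obtain ⟨q', hqN', hqO', rfl⟩ := lift y hy hyδ hya
      exact (hCt (mk_mem_prod (hOt hqO).1 (hOt hqO').1) hqN hqN').trans (by gcongr; exact le_max_left _ _)

end ConicPoint

/-! ### Transport to the manifold, and conclusion. -/

/-- A subset of a Riemannian manifold is locally Lipschitz normally embedded where it is conic. -/
theorem IsConicAt.exists_innerEDist_le {n : ℕ} {M : Type*} [PseudoEMetricSpace M]
    [ChartedSpace (EuclideanSpace ℝ (Fin n)) M] [IsManifold (𝓡 n) ∞ M]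
    [RiemannianBundle (fun x : M => TangentSpace (𝓡 n) x)]
    [IsContMDiffRiemannianBundle (𝓡 n) ∞ (EuclideanSpace ℝ (Fin n))
      (fun x : M => TangentSpace (𝓡 n) x)]
    [IsRiemannianManifold (𝓡 n) M] {W : Set M} {z : M} (h : IsConicAt n W z) :
    ∃ L : ℝ≥0, ∀ᶠ p in 𝓝 (z, z), p.1 ∈ W → p.2 ∈ W →
      innerEDist W p.1 p.2 ≤ L * edist p.1 p.2 := by
  obtain ⟨ψ, hψ, hc⟩ := h
  obtain ⟨K₁, s₁, hs₁, hK₁⟩ := exists_lipschitzOnWith_chart hψ.mem_atlas hψ.mem_source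
  obtain ⟨K₂, s₂, hs₂, hK₂⟩ := exists_lipschitzOnWith_chart_symm hψ.mem_atlas hψ.mem_source
  obtain ⟨L, hL⟩ := hc.exists_innerEDist_le hs₂
  have hψc := ψ.continuousAt hψ.mem_source
  have hψc2 : ContinuousAt (Prod.map ψ ψ) (z, z) := hψc.prodMap hψc
  -- Paths are confined to `s₂`, where the inverse chart is Lipschitz, so their lengths can be
  -- compared in `M`.
  have hmaps : MapsTo ψ.symm (ψ '' (W ∩ ψ.source) ∩ s₂) W := by
    rintro _ ⟨⟨w, ⟨hw, hws⟩, rfl⟩, -⟩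
    rwa [ψ.left_inv hws]
  refine ⟨(K₂ + 1) * (L * K₁), ?_⟩
  have hs : s₁ ∩ ψ.source ∈ 𝓝 z :=
    Filter.inter_mem hs₁ (ψ.open_source.mem_nhds hψ.mem_source)
  filter_upwards [prod_mem_nhds hs hs, hψc2.eventually hL] with ⟨x, y⟩ ⟨hx, hy⟩ hxy hxW hyW
  dsimp only [Prod.map] at hx hy hxy hxW hyW ⊢
  -- `K₂ + 1` replaces `K₂` to have a non-zero Lipschitz constant.
  have h1 := innerEDist_map_le (K := K₂ + 1) (by positivity)
    ((hK₂.mono inter_subset_right).weaken le_self_add) hmaps (ψ x) (ψ y)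
  rw [ψ.left_inv hx.2, ψ.left_inv hy.2] at h1
  calc innerEDist W x y ≤ (K₂ + 1 : ℝ≥0) * innerEDist (ψ '' (W ∩ ψ.source) ∩ s₂) (ψ x) (ψ y) := h1
    _ ≤ (K₂ + 1 : ℝ≥0) * (L * (K₁ * edist x y)) := by
        gcongr
        exact (hxy (mem_image_of_mem ψ ⟨hxW, hx.2⟩) (mem_image_of_mem ψ ⟨hyW, hy.2⟩)).trans
          (by gcongr; exact hK₁ hx.1 hy.1)
    _ = _ := by push_cast; ring

end ConicLNE

theorem theorem3p2 (n : ℕ) (M : Type*) [EMetricSpace M]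
    [ChartedSpace (EuclideanSpace ℝ (Fin n)) M] [IsManifold (𝓡 n) ∞ M]
    [RiemannianBundle (fun x : M => TangentSpace (𝓡 n) x)]
    [IsContMDiffRiemannianBundle (𝓡 n) ∞ (EuclideanSpace ℝ (Fin n))
      (fun x : M => TangentSpace (𝓡 n) x)]
    [IsRiemannianManifold (𝓡 n) M]
    (W : Set M) (hconic : ConicLNE.IsConicSingularSubmanifold n W)
    (hcompact : IsCompact W) (hconn : IsConnected W) :
    ConicLNE.IsLNE W :=
  ConicLNE.isLNE_of_locally hcompact hconn.isPreconnected fun z hz ↦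
    (hconic.conic z hz).exists_innerEDist_le
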